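/- Let $n,k\ge 0$ be integers and let $x_1,\dots,x_n\ge 0$ and $y_1,\dots,y_k\ge 0$ be real numbers. For a partition $\lambda=(\lambda_1\ge\lambda_2\ge\cdots)$ whose Young diagram is contained in the $n\times k$ rectangle (at most $n$ rows, $\lambda_1\le k$) let $$\mu_{n,k}(\lambda\mid x,y)=\frac{s_\lambda(x_1,\dots,x_n)\,s_{\lambda'}(y_1,\dots,y_k)}{\prod_{i=1}^n\prod_{j=1}^k(1+x_iy_j)},$$ where $\lambda'$ is the conjugate partition and $s_\lambda(x_1,\dots,x_n)=\sum_T\prod_{i=1}^n x_i^{T_i}$ is the Schur polynomial, the sum being over the semistandard Young tableaux $T$ of shape $\lambda$ with entries in $\{1,\dots,n\}$, and $T_i$ being the number of boxes of $T$ with entry $i$. Put $a_i=a_i(\lambda)=\lambda_i-i+\tfrac12\in\mathbb Z+\tfrac12$ for $i\ge1$, and $$K(z)=\prod_{i=1}^n\frac1{1-x_iz}\prod_{j=1}^k\frac1{1+y_j/z}.$$ Call a pair of closed piecewise $C^1$ contours $\gamma_z,\gamma_w$ in $\mathbb C$ admissible if $|w|<|z|$ for all $w\in\gamma_w$, $z\in\gamma_z$;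 $\gamma_w$ goes once, counterclockwise, around $0$; $\gamma_z$ goes once, counterclockwise, around $0$ and around every $-y_j$; and every $x_i^{-1}$ with $x_i\ne0$ lies outside $\gamma_z$ (that is: the respective points are off the contours, and the winding numbers about them are $1$, $1$ and $0$). Then admissible pairs exist, and for $m,m'\in\mathbb Z+\tfrac12$ the integral $$\mathcal K(m,m')=\oint_{\gamma_z}\frac{dz}{2\pi\mathrm i z}\oint_{\gamma_w}\frac{dw}{2\pi\mathrm i w}\,\frac{K(z)}{K(w)}\,z^{-m}w^{m'}\frac{\sqrt{zw}}{z-w}$$ (where $z^{-m}w^{m'}\sqrt{zw}$ means the single-valued function $z^{1/2-m}w^{m'+1/2}$) does not depend on the admissible pair. The measure $\mu_{n,k}(\,\cdot\mid x,y)$ is determinantal with correlation kernel $\mathcal K$: for every $\lambda$ in the $n\times k$ rectangle $$\mu_{n,k}(\lambda\mid x,y)=\det\bigl[\mathcal K(a_i,a_j)\bigr]_{i,j=1}^n,$$ and, for every $r\ge0$ and all distinct $s_1,\dots,s_r\in\mathbb Z+\tfrac12$, $$\sum_{\lambda:\ \{s_1,\dots,s_r\}\subseteq\{a_i(\lambda)\,:\,i\ge1\}}\mu_{n,k}(\lambda\mid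 x,y)=\det\bigl[\mathcal K(s_i,s_j)\bigr]_{i,j=1}^r,$$ where the sum is over the partitions $\lambda$ in the $n\times k$ rectangle. (For $r=0$ this says that $\mu_{n,k}$ has total mass $1$.) -/

import Mathlib

open scoped BigOperators

noncomputable section

namespace DualCauchy

/-! ### Schur polynomials and the dual Cauchy measure -/

/-- Semistandard Young tableaux of shape `lam` whose entries are among the `n` letters
`0, …, n - 1` (the letters are numbered from `0`, as the variables `x : Fin n → ℝ` are). -/
def BoundedSSYT (lam : YoungDiagram) (n : ℕ) : Type :=
  {T : SemistandardYoungTableau lam // ∀ c ∈ lam.cells, T c.1 c.2 < n}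

instance (lam : YoungDiagram) (n : ℕ) : Finite (BoundedSSYT lam n) := by
  let f : BoundedSSYT lam n → (lam.cells → Fin n) :=
    fun T c => ⟨T.1 c.1.1 c.1.2, T.2 c.1 c.2⟩
  refine Finite.of_injective f ?_
  intro T T' h
  apply Subtype.ext
  ext i j
  by_cases hc : (i, j) ∈ lam
  · have := congrFun h ⟨(i, j), (YoungDiagram.mem_cells _).2 hc⟩
    simpa [f] using this
  · rw [T.1.zeros hc, T'.1.zeros hc]

instance (lam : YoungDiagram) (n : ℕ) : Fintype (BoundedSSYT lam n) :=
  Fintype.ofFinite _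

/-- The number of boxes of `T` with the entry `i`. -/
def BoundedSSYT.weight {lam : YoungDiagram} {n : ℕ} (T : BoundedSSYT lam n) (i : Fin n) : ℕ :=
  (lam.cells.filter fun c => T.1 c.1 c.2 = (i : ℕ)).card

/-- The Schur polynomial `s_lam(x_1, …, x_n)`, as a sum over semistandard tableaux. -/
def schur {n : ℕ} (lam : YoungDiagram) (x : Fin n → ℝ) : ℝ :=
  ∑ T : BoundedSSYT lam n, ∏ i : Fin n, x i ^ T.weight i

/-- The Young diagrams with at most `n` rows and at most `k` columns. -/
def boxDiagrams (n k : ℕ) : Finset YoungDiagram :=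
  (Finset.range n ×ˢ Finset.range k).powerset.preimage YoungDiagram.cells
    (fun _ _ _ _ h => YoungDiagram.ext h)

/-- The weight of the diagram `lam ⊆ n × k` under the dual Cauchy measure. -/
def dualCauchyMeasure {n k : ℕ} (x : Fin n → ℝ) (y : Fin k → ℝ) (lam : YoungDiagram) : ℝ :=
  schur lam x * schur lam.transpose y / ∏ i : Fin n, ∏ j : Fin k, (1 + x i * y j)

/-! ### Maya coordinates and correlation functions -/

/-- The shifted lattice `ℤ + 1/2`. -/
def halfIntegers : Set ℝ := {m | ∃ a : ℤ, m = a + 1 / 2}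

/-- The Maya coordinate `lam_i - i + 1/2` of the `i`-th row; rows are counted from `0` here,
so that row `i` is the `(i + 1)`-st row in the usual numbering. -/
def mayaCoord (lam : YoungDiagram) (i : ℕ) : ℝ :=
  (lam.rowLen i : ℝ) - ((i : ℝ) + 1) + 1 / 2

/-- The Maya diagram of `lam`: the infinite set of all its Maya coordinates. -/
def mayaDiagram (lam : YoungDiagram) : Set ℝ := Set.range (mayaCoord lam)

open Classical in
/-- The correlation function of the point process of Maya diagrams: the probability, under the
dual Cauchy measure, that all the points `s_1, …, s_r` are occupied. -/
def correlation {n k : ℕ} (x : Fin n → ℝ) (y : Fin k → ℝ) {r : ℕ} (s : Fin r → ℝ) : ℝ :=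
  ∑ lam ∈ (boxDiagrams n k).filter (fun lam => ∀ i, s i ∈ mayaDiagram lam),
    dualCauchyMeasure x y lam

/-! ### Contours -/

/-- Closed piecewise continuously differentiable curves, parametrized by `[0, 1]`. -/
def IsContour (γ : ℝ → ℂ) : Prop :=
  γ 0 = γ 1 ∧ ∃ (N : ℕ) (t : ℕ → ℝ), Monotone t ∧ t 0 = 0 ∧ t N = 1 ∧
    ∀ i < N, ContDiffOn ℝ 1 γ (Set.Icc (t i) (t (i + 1)))

/-- The image of a contour. -/
def trace (γ : ℝ → ℂ) : Set ℂ := γ '' Set.Icc 0 1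

/-- The integral of `f` along `γ`. -/
def contourIntegral (γ : ℝ → ℂ) (f : ℂ → ℂ) : ℂ :=
  ∫ t in (0 : ℝ)..1, f (γ t) * deriv γ t

/-- The winding number of `γ` about a point `p` off `γ`. -/
def windingNumber (γ : ℝ → ℂ) (p : ℂ) : ℂ :=
  (2 * Real.pi * Complex.I)⁻¹ * contourIntegral γ (fun z => (z - p)⁻¹)

/-- `γ` goes once around `p`, in the positive direction. -/
def Encircles (γ : ℝ → ℂ) (p : ℂ) : Prop := p ∉ trace γ ∧ windingNumber γ p = 1

/-- `p` lies outside `γ`. -/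
def Excludes (γ : ℝ → ℂ) (p : ℂ) : Prop := p ∉ trace γ ∧ windingNumber γ p = 0

/-- The contours of the double integral: `|w| < |z|` on them, both go once around `0`, the
`z`-contour contains every `-y_j` and contains no `x_i⁻¹` (for `x_i = 0` there is no such point). -/
structure AdmissibleContours {n k : ℕ} (x : Fin n → ℝ) (y : Fin k → ℝ) (γz γw : ℝ → ℂ) :
    Prop where
  contour_z : IsContour γz
  contour_w : IsContour γw
  norm_lt : ∀ z ∈ trace γz, ∀ w ∈ trace γw, ‖w‖ < ‖z‖
  zero_z : Encircles γz 0
  zero_w : Encircles γw 0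
  contains_y : ∀ j, Encircles γz (-(y j : ℂ))
  excludes_x : ∀ i, x i ≠ 0 → Excludes γz ((x i : ℂ)⁻¹)

/-! ### The kernel -/

/-- `K(z) = ∏ 1 / (1 - x_i z) · ∏ 1 / (1 + y_j / z)`. -/
def symbolK {n k : ℕ} (x : Fin n → ℝ) (y : Fin k → ℝ) (z : ℂ) : ℂ :=
  (∏ i : Fin n, 1 / (1 - (x i : ℂ) * z)) * ∏ j : Fin k, 1 / (1 + (y j : ℂ) / z)

/-- The integrand `K(z)/K(w) · z^{-m} w^{m'} · √(zw) / (z - w)`. All the powers are taken with one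
and the same (principal) branch of the logarithm, and `√(zw) = z^{1/2} w^{1/2}`; for half-integers
`m, m'` the product is then the single-valued function `z^{1/2 - m} w^{m' + 1/2}`. -/
def kernelIntegrand {n k : ℕ} (x : Fin n → ℝ) (y : Fin k → ℝ) (m m' : ℝ) (z w : ℂ) : ℂ :=
  symbolK x y z / symbolK x y w * (z ^ (-(m : ℂ)) * w ^ (m' : ℂ)) *
    ((z ^ (1 / 2 : ℂ) * w ^ (1 / 2 : ℂ)) / (z - w))

/-- The double contour integral, with respect to `dz / (2πi z)` and `dw / (2πi w)`. -/
def kernelIntegral {n k : ℕ} (x : Fin n → ℝ) (y : Fin k → ℝ) (γz γw : ℝ → ℂ) (m m' : ℝ) : ℂ :=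
  contourIntegral γz fun z =>
    1 / (2 * Real.pi * Complex.I * z) *
      contourIntegral γw fun w =>
        1 / (2 * Real.pi * Complex.I * w) * kernelIntegrand x y m m' z w

end DualCauchy

end

noncomputable section

namespace DualCauchy

/-! ### Integer coordinates of diagrams in a box -/

/-! The measure is a biorthogonal ensemble, and everything is expressed through the two-sided
sequence u_a = (2πi)⁻¹ ∮ K(z) z^{-a-1} dz along the z-contour (`contourCoeff`). With S the shift,
(Su)_a = u_{a-1}, two facts about u suffice. First, ∏(1 - x_i S) u vanishes at every a ≥ 1, because
it is the coefficient sequence of ∏ 1/(1 + y_j/z), all of whose poles are encircled. Second, ∏(1 +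
y_j S⁻¹) u = h(x), the complete symmetric sequence, because the x-poles are excluded.

Kernel. 1/K(w) is a Laurent polynomial, and the w-integral of w^q/(z - w) is 2πi z^q for q < 0 and 0
otherwise. So the double integral is a finite sum `kerZ` in the u_a. It depends on the contours only
through u, and partial fractions show that u depends only on the winding numbers about the poles and
0.

Weights. Put φ_l(M) = e_{M+l}(y), and let ψ_l (`partner`) be a unitriangular combination of the
shifts u_{M+t}, 0 ≤ t ≤ l. Dual Jacobi–Trudi gives s_{λ'}(y) = det φ. By the first fact det ψ =
s_λ(x) · det[u_{t-i}] (Jacobi–Trudi and `det_eq_det_hZ_mul`). By both facts det[u_{t-i}] · ∏(1 + x_i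
y_j) = det[h_{t-i}] = 1 (`det_backward`). Hence the weight of λ is det ψ · det φ.

Correlations. On the window 1-n, …, k the families ψ, φ are biorthonormal (`sum_partner_mul_eZ`),
and `kerZ` is Σ_l ψ_l(M) φ_l(M') (`kerZ_eq_sum_partner`). Cauchy–Binet with the weights 1 + X on the
prescribed points, followed by det(1 + AB) = det(1 + BA), yields the correlation functions
(`sum_det_mul_det_eq_det`). Sites above the window are always empty and sites below it always
occupied; the kernel columns there are 0 and δ respectively.

Both Jacobi–Trudi formulas are proved by induction on the number of variables: one letter acts on
determinants by a transfer matrix whose minors are the one-variable skew weights, and Cauchy–Binet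
matches the branching rule. -/

/-- The integer `lam_i - i` (rows counted from `0`); it is the Maya coordinate plus `1 / 2`. -/
def coord (lam : YoungDiagram) (i : ℕ) : ℤ := (lam.rowLen i : ℤ) - i

theorem mem_boxDiagrams {n k : ℕ} {lam : YoungDiagram} :
    lam ∈ boxDiagrams n k ↔ ∀ i j, (i, j) ∈ lam → i < n ∧ j < k := by
  have h : lam ∈ boxDiagrams n k ↔ lam.cells ∈ (Finset.range n ×ˢ Finset.range k).powerset :=
    Finset.mem_preimage
  rw [h, Finset.mem_powerset, Finset.subset_iff]
  simp only [YoungDiagram.mem_cells, Finset.mem_product, Finset.mem_range, Prod.forall]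

theorem rowLen_le_of_mem_box {n k : ℕ} {lam : YoungDiagram} (h : lam ∈ boxDiagrams n k) (i : ℕ) :
    lam.rowLen i ≤ k := by
  by_contra! hk
  exact absurd (mem_boxDiagrams.1 h i k (YoungDiagram.mem_iff_lt_rowLen.2 hk)).2 (lt_irrefl _)

theorem rowLen_eq_zero_of_mem_box {n k : ℕ} {lam : YoungDiagram} (h : lam ∈ boxDiagrams n k)
    {i : ℕ} (hi : n ≤ i) : lam.rowLen i = 0 := by
  by_contra! hk
  have := (mem_boxDiagrams.1 h i 0 (YoungDiagram.mem_iff_lt_rowLen.2 (Nat.pos_of_ne_zero hk))).1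
  omega

theorem coord_strictAnti (lam : YoungDiagram) : StrictAnti (coord lam) := by
  intro i j hij
  have := lam.rowLen_anti i j hij.le
  simp only [coord]
  omega

theorem coord_mem_Icc {n k : ℕ} {lam : YoungDiagram} (h : lam ∈ boxDiagrams n k) (i : Fin n) :
    coord lam i ∈ Finset.Icc (1 - (n : ℤ)) k := by
  have := rowLen_le_of_mem_box h i
  have := i.2
  simp only [coord, Finset.mem_Icc]
  omega

theorem eq_of_coord_eq {n k : ℕ} {lam mu : YoungDiagram} (h : lam ∈ boxDiagrams n k)
    (h' : mu ∈ boxDiagrams n k) (he : ∀ i : Fin n, coord lam i = coord mu i) : lam = mu := by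
  have key : ∀ i, lam.rowLen i = mu.rowLen i := by
    intro i
    by_cases hi : i < n
    · have := he ⟨i, hi⟩
      simp only [coord] at this
      omega
    · rw [rowLen_eq_zero_of_mem_box h (not_lt.1 hi), rowLen_eq_zero_of_mem_box h' (not_lt.1 hi)]
  apply YoungDiagram.ext
  ext ⟨i, j⟩
  simp only [YoungDiagram.mem_cells, YoungDiagram.mem_iff_lt_rowLen, key]

/-- Strict decrease of c makes c_i + i weakly decreasing, and the window bounds put it between 0 and
k; these numbers are the row lengths. -/
theorem exists_diagram_of_strictAnti {n k : ℕ} {c : Fin n → ℤ} (hc : StrictAnti c)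
    (hS : ∀ i, c i ∈ Finset.Icc (1 - (n : ℤ)) k) :
    ∃ lam ∈ boxDiagrams n k, ∀ i : Fin n, coord lam i = c i := by
  have hstep : ∀ (d : ℕ) (i j : Fin n), (j : ℕ) = i + d → c j + d ≤ c i := by
    intro d
    induction d with
    | zero => intro i j h; have : j = i := Fin.ext (by omega); simp [this]
    | succ d ih =>
      intro i j h
      have hj := j.2
      have h1 := ih i ⟨i + d, by omega⟩ rfl
      have h2 : c j < c ⟨i + d, by omega⟩ := hc (by rw [Fin.lt_def]; simp; omega)
      push_cast
      omega
  -- Compare with the last entry, which is at least 1 - n.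
  have hnn : ∀ i : Fin n, 0 ≤ c i + i := by
    intro i
    have hi := i.2
    have h1 := hstep (n - 1 - i) i ⟨n - 1, by omega⟩ (by simp; omega)
    have h2 := (Finset.mem_Icc.1 (hS ⟨n - 1, by omega⟩)).1
    omega
  let lam : YoungDiagram :=
    { cells := (Finset.range n ×ˢ Finset.range k).filter
        fun p => ∃ h : p.1 < n, (p.2 : ℤ) < c ⟨p.1, h⟩ + p.1
      isLowerSet := by
        rintro ⟨i, j⟩ ⟨i', j'⟩ hle hmem
        have hle1 : i' ≤ i := hle.1
        have hle2 : j' ≤ j := hle.2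
        simp only [Finset.coe_filter, Finset.mem_product, Finset.mem_range,
          Set.mem_ofPred_eq] at hmem ⊢
        obtain ⟨⟨h1, h2⟩, h3, h4⟩ := hmem
        refine ⟨⟨by omega, by omega⟩, by omega, ?_⟩
        have := hstep (i - i') ⟨i', by omega⟩ ⟨i, h3⟩ (by simp; omega)
        omega }
  have hmem : ∀ (i : Fin n) j, ((i : ℕ), j) ∈ lam ↔ (j : ℤ) < c i + i := by
    intro i j
    rw [← YoungDiagram.mem_cells]
    simp only [lam, Finset.mem_filter, Finset.mem_product, Finset.mem_range, Fin.eta,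
      Fin.is_lt, exists_true_left, true_and, and_iff_right_iff_imp]
    intro h
    by_cases h0 : (i : ℕ) = 0
    · have := (Finset.mem_Icc.1 (hS i)).2
      omega
    · have h1 := hstep i ⟨0, by have := i.2; omega⟩ i (by simp)
      have := (Finset.mem_Icc.1 (hS ⟨0, by have := i.2; omega⟩)).2
      omega
  refine ⟨lam, ?_, ?_⟩
  · rw [mem_boxDiagrams]
    intro i j h
    rw [← YoungDiagram.mem_cells] at h
    simp only [lam, Finset.mem_filter, Finset.mem_product, Finset.mem_range] at h
    exact h.1
  · intro i
    have h1 : ∀ j : ℕ, j < lam.rowLen i ↔ (j : ℤ) < c i + i := fun j => by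
      rw [← YoungDiagram.mem_iff_lt_rowLen, hmem]
    have h2 := h1 (c i + i).toNat
    have h3 := h1 (lam.rowLen i)
    have h4 := hnn i
    simp only [coord]
    omega

/-! ### The Cauchy–Binet formula -/

theorem det_sum_mul_eq_sum_pi {R : Type*} [CommRing R] {N : ℕ} (S : Finset ℤ)
    (f g : Fin N → ℤ → R) :
    Matrix.det (Matrix.of fun i j : Fin N => ∑ a ∈ S, f i a * g j a) =
      ∑ φ ∈ Fintype.piFinset fun _ : Fin N => S,
        (∏ i, f i (φ i)) * Matrix.det (Matrix.of fun i j : Fin N => g j (φ i)) := by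
  have h := (Matrix.detRowAlternating (n := Fin N) (R := R)).toMultilinearMap.map_sum_finset
    (fun i a => f i a • (fun j => g j a : Fin N → R)) (fun _ => S)
  have e1 : (Matrix.of fun i j : Fin N => ∑ a ∈ S, f i a * g j a) =
      fun i => ∑ a ∈ S, f i a • (fun j => g j a : Fin N → R) := by
    ext i j
    simp [Finset.sum_apply]
  rw [e1]
  refine h.trans (Finset.sum_congr rfl fun φ _ => ?_)
  exact (Matrix.detRowAlternating (n := Fin N) (R := R)).toMultilinearMap.map_smul_univ _ _

/-- Cauchy–Binet: the N-element subsets of the window are exactly the coordinate sets of diagrams in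
the box. The ring is general because the correlation argument needs polynomial coefficients. -/
theorem det_sum_mul_eq_sum_boxDiagrams {R : Type*} [CommRing R] (N k : ℕ) (f g : Fin N → ℤ → R) :
    Matrix.det (Matrix.of fun i j : Fin N => ∑ a ∈ Finset.Icc (1 - (N : ℤ)) k, f i a * g j a) =
      ∑ lam ∈ boxDiagrams N k,
        Matrix.det (Matrix.of fun i j : Fin N => f i (coord lam j)) *
          Matrix.det (Matrix.of fun i j : Fin N => g i (coord lam j)) := by
  classical
  rw [det_sum_mul_eq_sum_pi]
  set S := Finset.Icc (1 - (N : ℤ)) k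
  -- A map with a repeated value gives a determinant with two equal rows; an injective map is a
  -- decreasing sequence composed with a permutation.
  rw [← Finset.sum_filter_of_ne (p := Function.Injective)]
  swap
  · intro φ _ hne
    by_contra hni
    apply hne
    simp only [Function.Injective, not_forall] at hni
    obtain ⟨a, b, hab, hne'⟩ := hni
    rw [Matrix.det_zero_of_row_eq hne', mul_zero]
    ext j
    simp [hab]
  have hR : ∀ lam ∈ boxDiagrams N k,
      Matrix.det (Matrix.of fun i j : Fin N => f i (coord lam j)) *
          Matrix.det (Matrix.of fun i j : Fin N => g i (coord lam j)) =
      ∑ σ : Equiv.Perm (Fin N), (∏ i, f i (coord lam (σ i))) *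
        Matrix.det (Matrix.of fun i j : Fin N => g j (coord lam (σ i))) := by
    intro lam _
    rw [← Matrix.det_transpose, Matrix.det_apply', Finset.sum_mul]
    refine Finset.sum_congr rfl fun σ _ => ?_
    have h2 := Matrix.det_permute σ (Matrix.of fun i j : Fin N => g i (coord lam j)).transpose
    rw [Matrix.det_transpose] at h2
    have e : (Matrix.of fun i j : Fin N => g j (coord lam (σ i))) =
      (Matrix.of fun i j : Fin N => g i (coord lam j)).transpose.submatrix σ id := by
      ext i j; simp
    rw [e, h2]
    simp only [Matrix.transpose_apply, Matrix.of_apply]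
    ring
  rw [Finset.sum_congr rfl hR, ← Finset.sum_product']
  symm
  refine Finset.sum_bij (fun p _ => fun i => coord p.1 (p.2 i)) ?_ ?_ ?_ ?_
  · rintro ⟨lam, σ⟩ h
    have h1 := (Finset.mem_product.1 h).1
    simp only [Finset.mem_filter, Fintype.mem_piFinset]
    refine ⟨fun i => coord_mem_Icc h1 _, fun a b hab => ?_⟩
    exact σ.injective (Fin.ext ((coord_strictAnti lam).injective hab))
  · rintro ⟨lam, σ⟩ h ⟨mu, τ⟩ h' he
    have h1 := (Finset.mem_product.1 h).1
    have h1' := (Finset.mem_product.1 h').1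
    have he' : ∀ i, coord lam (σ i) = coord mu (τ i) := fun i => congrFun he i
    have hanti : ∀ nu : YoungDiagram, StrictMono fun i : Fin N => OrderDual.toDual (coord nu i) :=
      fun nu i j hij => coord_strictAnti nu hij
    have hr : Set.range (fun i : Fin N => OrderDual.toDual (coord lam i)) =
        Set.range fun i : Fin N => OrderDual.toDual (coord mu i) := by
      ext a
      constructor
      · rintro ⟨i, rfl⟩
        exact ⟨τ (σ.symm i), by simp [← he']⟩
      · rintro ⟨i, rfl⟩
        exact ⟨σ (τ.symm i), by simp [he']⟩
    have hc := (StrictMono.range_inj (hanti lam) (hanti mu)).1 hr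
    have hlm : lam = mu := eq_of_coord_eq h1 h1' fun i => congrFun hc i
    subst hlm
    have : σ = τ := by
      ext i
      rw [(coord_strictAnti lam).injective (he' i)]
    rw [this]
  · intro φ hφ
    simp only [Finset.mem_filter, Fintype.mem_piFinset] at hφ
    obtain ⟨hS, hinj⟩ := hφ
    let σ := Tuple.sort (OrderDual.toDual ∘ φ)
    have hm : Monotone ((OrderDual.toDual ∘ φ) ∘ σ) := Tuple.monotone_sort _
    have ha : StrictAnti (φ ∘ σ) := by
      intro i j hij
      refine lt_of_le_of_ne (hm hij.le) fun h => ?_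
      exact hij.ne' (σ.injective (hinj h))
    obtain ⟨lam, hl, hc⟩ := exists_diagram_of_strictAnti (k := k) ha fun i => hS _
    refine ⟨(lam, σ.symm), Finset.mem_product.2 ⟨hl, Finset.mem_univ _⟩, ?_⟩
    funext i
    simp [hc]
  · rintro ⟨lam, σ⟩ _
    rfl

/-! ### The branching rule for Schur polynomials -/

/-- `lam / mu` is a horizontal strip: it has at most one box in every column. -/
def IsHorizontalStrip (mu lam : YoungDiagram) : Prop :=
  mu ≤ lam ∧ ∀ i j, (i + 1, j) ∈ lam → (i, j) ∈ mu

/-- The entry of a tableau in the box `(i, j)`. -/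
def BoundedSSYT.entry {lam : YoungDiagram} {n : ℕ} (T : BoundedSSYT lam n) (i j : ℕ) : ℕ :=
  T.1 i j

theorem BoundedSSYT.weight_eq_card {lam : YoungDiagram} {n : ℕ} (T : BoundedSSYT lam n)
    (i : Fin n) : T.weight i = (lam.cells.filter fun c => T.entry c.1 c.2 = (i : ℕ)).card := rfl

theorem BoundedSSYT.entry_lt {lam : YoungDiagram} {n : ℕ} (T : BoundedSSYT lam n) {i j : ℕ}
    (h : (i, j) ∈ lam) : T.entry i j < n :=
  T.2 (i, j) ((YoungDiagram.mem_cells _).2 h)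

theorem BoundedSSYT.entry_eq_zero {lam : YoungDiagram} {n : ℕ} (T : BoundedSSYT lam n) {i j : ℕ}
    (h : (i, j) ∉ lam) : T.entry i j = 0 :=
  T.1.zeros h

theorem BoundedSSYT.entry_lt_entry {lam : YoungDiagram} {n : ℕ} (T : BoundedSSYT lam n)
    {i i' j : ℕ} (hi : i < i') (h : (i', j) ∈ lam) : T.entry i j < T.entry i' j :=
  T.1.col_strict hi h

theorem BoundedSSYT.entry_le_entry {lam : YoungDiagram} {n : ℕ} (T : BoundedSSYT lam n)
    {i j j' : ℕ} (hj : j < j') (h : (i, j') ∈ lam) : T.entry i j ≤ T.entry i j' :=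
  T.1.row_weak hj h

theorem BoundedSSYT.ext_entry {lam : YoungDiagram} {n : ℕ} {T T' : BoundedSSYT lam n}
    (h : ∀ i j, T.entry i j = T'.entry i j) : T = T' :=
  Subtype.ext (SemistandardYoungTableau.ext h)

/-- The boxes of a tableau with entries less than `m`. -/
def BoundedSSYT.shapeBelow {lam : YoungDiagram} {n : ℕ} (T : BoundedSSYT lam n) (m : ℕ) :
    YoungDiagram where
  cells := lam.cells.filter fun c => T.entry c.1 c.2 < m
  isLowerSet := by
    rintro ⟨i, j⟩ ⟨i', j'⟩ hle hmem
    have h1 : i' ≤ i := hle.1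
    have h2 : j' ≤ j := hle.2
    simp only [Finset.coe_filter, YoungDiagram.mem_cells, Set.mem_ofPred_eq] at hmem ⊢
    refine ⟨lam.up_left_mem h1 h2 hmem.1, lt_of_le_of_lt ?_ hmem.2⟩
    exact (T.1.col_weak h1 (lam.up_left_mem le_rfl h2 hmem.1)).trans
      (T.1.row_weak_of_le h2 hmem.1)

theorem BoundedSSYT.mem_shapeBelow {lam : YoungDiagram} {n : ℕ} {T : BoundedSSYT lam n} {m : ℕ}
    {i j : ℕ} : (i, j) ∈ T.shapeBelow m ↔ (i, j) ∈ lam ∧ T.entry i j < m := by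
  rw [← YoungDiagram.mem_cells]
  simp [shapeBelow]

theorem BoundedSSYT.isHorizontalStrip_shapeBelow {lam : YoungDiagram} {m : ℕ}
    (T : BoundedSSYT lam (m + 1)) : IsHorizontalStrip (T.shapeBelow m) lam := by
  constructor
  · rintro ⟨i, j⟩ h
    exact (BoundedSSYT.mem_shapeBelow.1 h).1
  · intro i j h
    refine BoundedSSYT.mem_shapeBelow.2 ⟨lam.up_left_mem (Nat.le_succ i) le_rfl h, ?_⟩
    have h1 := T.entry_lt_entry (Nat.lt_add_one i) h
    have h2 := T.entry_lt h
    omega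

/-- Fill the boxes of the horizontal strip `lam / mu` with the letter `m`. -/
def BoundedSSYT.extend {mu lam : YoungDiagram} {m : ℕ} (h : IsHorizontalStrip mu lam)
    (T : BoundedSSYT mu m) : BoundedSSYT lam (m + 1) :=
  ⟨{ entry := fun i j => if (i, j) ∈ mu then T.1 i j else if (i, j) ∈ lam then m else 0
     row_weak' := by
      intro i j1 j2 hj hl
      have hl1 := lam.up_left_mem le_rfl hj.le hl
      by_cases h2 : (i, j2) ∈ mu
      · have h1 := mu.up_left_mem le_rfl hj.le h2
        simp only [h1, h2, if_true]
        exact T.entry_le_entry hj h2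
      · simp only [h2, if_false, hl, if_true, hl1]
        split_ifs with h1
        · exact (T.entry_lt h1).le
        · exact le_rfl
     col_strict' := by
      intro i1 i2 j hi hl
      have h1 : (i1, j) ∈ mu := h.2 i1 j (lam.up_left_mem hi le_rfl hl)
      simp only [h1, if_true, hl]
      split_ifs with h2
      · exact T.entry_lt_entry hi h2
      · exact T.entry_lt h1
     zeros' := by
      intro i j hl
      have h1 : (i, j) ∉ mu := fun hm => hl (h.1 hm)
      simp [h1, hl] }, by
    rintro ⟨i, j⟩ hc
    change (if (i, j) ∈ mu then T.entry i j else if (i, j) ∈ lam then m else 0) < m + 1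
    split_ifs with h1 h2
    · exact (T.entry_lt h1).trans (Nat.lt_succ_self m)
    · exact Nat.lt_succ_self m
    · exact Nat.succ_pos m⟩

theorem BoundedSSYT.extend_apply {mu lam : YoungDiagram} {m : ℕ} (h : IsHorizontalStrip mu lam)
    (T : BoundedSSYT mu m) (i j : ℕ) : (T.extend h).entry i j =
      if (i, j) ∈ mu then T.entry i j else if (i, j) ∈ lam then m else 0 := rfl

theorem BoundedSSYT.shapeBelow_extend {mu lam : YoungDiagram} {m : ℕ}
    (h : IsHorizontalStrip mu lam) (T : BoundedSSYT mu m) : (T.extend h).shapeBelow m = mu := by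
  apply YoungDiagram.ext
  ext ⟨i, j⟩
  rw [YoungDiagram.mem_cells, YoungDiagram.mem_cells, BoundedSSYT.mem_shapeBelow, extend_apply]
  constructor
  · rintro ⟨h1, h2⟩
    by_contra hm
    simp [hm, h1] at h2
  · intro hm
    refine ⟨h.1 hm, ?_⟩
    simp only [hm, if_true]
    exact T.entry_lt hm

theorem BoundedSSYT.extend_injective {mu lam : YoungDiagram} {m : ℕ}
    (h : IsHorizontalStrip mu lam) :
    Function.Injective (BoundedSSYT.extend h : BoundedSSYT mu m → _) := by
  intro T T' he
  refine BoundedSSYT.ext_entry fun i j => ?_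
  by_cases hm : (i, j) ∈ mu
  · have := congrArg (fun U : BoundedSSYT lam (m + 1) => U.entry i j) he
    simpa only [extend_apply, hm, if_true] using this
  · rw [T.entry_eq_zero hm, T'.entry_eq_zero hm]

theorem BoundedSSYT.exists_extend_eq {mu lam : YoungDiagram} {m : ℕ}
    (h : IsHorizontalStrip mu lam) (T : BoundedSSYT lam (m + 1)) (hT : T.shapeBelow m = mu) :
    ∃ T' : BoundedSSYT mu m, T'.extend h = T := by
  subst hT
  refine ⟨⟨{ entry := fun i j => if (i, j) ∈ T.shapeBelow m then T.entry i j else 0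
             row_weak' := ?_
             col_strict' := ?_
             zeros' := ?_ }, ?_⟩, ?_⟩
  · intro i j1 j2 hj h2
    have h1 := (T.shapeBelow m).up_left_mem le_rfl hj.le h2
    simp only [h1, h2, if_true]
    exact T.entry_le_entry hj (h.1 h2)
  · intro i1 i2 j hi h2
    have h1 := (T.shapeBelow m).up_left_mem hi.le le_rfl h2
    simp only [h1, h2, if_true]
    exact T.entry_lt_entry hi (h.1 h2)
  · intro i j hn
    simp [hn]
  · rintro ⟨i, j⟩ hc
    have hc' : (i, j) ∈ T.shapeBelow m := (YoungDiagram.mem_cells _).1 hc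
    change (if (i, j) ∈ T.shapeBelow m then T.entry i j else 0) < m
    rw [if_pos hc']
    exact (mem_shapeBelow.1 hc').2
  · refine BoundedSSYT.ext_entry fun i j => ?_
    change (if (i, j) ∈ T.shapeBelow m then (if (i, j) ∈ T.shapeBelow m then T.entry i j else 0)
      else if (i, j) ∈ lam then m else 0) = T.entry i j
    split_ifs with h1 h2
    · rfl
    · have h3 : ¬ T.entry i j < m := fun h3 => h1 (mem_shapeBelow.2 ⟨h2, h3⟩)
      have h4 : T.entry i j < m + 1 := T.entry_lt h2
      omega
    · exact (T.entry_eq_zero h2).symm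

theorem BoundedSSYT.weight_extend_castSucc {mu lam : YoungDiagram} {m : ℕ}
    (h : IsHorizontalStrip mu lam) (T : BoundedSSYT mu m) (i : Fin m) :
    (T.extend h).weight i.castSucc = T.weight i := by
  rw [weight_eq_card, weight_eq_card]
  congr 1
  ext ⟨a, b⟩
  have hi := i.2
  rw [Finset.mem_filter, Finset.mem_filter]
  simp only [YoungDiagram.mem_cells, extend_apply, Fin.val_castSucc]
  by_cases hm : (a, b) ∈ mu
  · simp [hm, h.1 hm]
  · simp only [hm, if_false, false_and, iff_false, not_and]
    intro hl
    simp only [hl, if_true]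
    omega

theorem BoundedSSYT.weight_extend_last {mu lam : YoungDiagram} {m : ℕ}
    (h : IsHorizontalStrip mu lam) (T : BoundedSSYT mu m) :
    (T.extend h).weight (Fin.last m) = lam.card - mu.card := by
  rw [weight_eq_card]
  unfold YoungDiagram.card
  rw [← Finset.card_sdiff_of_subset (YoungDiagram.cells_subset_iff.2 h.1)]
  congr 1
  ext ⟨a, b⟩
  rw [Finset.mem_filter, Finset.mem_sdiff]
  simp only [YoungDiagram.mem_cells, extend_apply, Fin.val_last]
  by_cases hm : (a, b) ∈ mu
  · have := T.entry_lt hm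
    simp only [hm, if_true, not_true, and_false, iff_false, not_and]
    omega
  · simp only [hm, if_false, not_false_eq_true, and_true, and_iff_left_iff_imp]
    intro hl
    simp [hl]

theorem mem_boxDiagrams_of_le {n k : ℕ} {mu lam : YoungDiagram} (h : mu ≤ lam)
    (hl : lam ∈ boxDiagrams n k) : mu ∈ boxDiagrams n k :=
  mem_boxDiagrams.2 fun i j hm => mem_boxDiagrams.1 hl i j (h hm)

-- Branching on the largest letter: its boxes form a horizontal strip, and removing them leaves a
-- tableau in the remaining letters. The box only serves to make the range of `mu` finite.
open Classical in
theorem schur_succ {m n k : ℕ} {lam : YoungDiagram} (hl : lam ∈ boxDiagrams n k)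
    (x : Fin (m + 1) → ℝ) : schur lam x =
      ∑ mu ∈ boxDiagrams n k, if IsHorizontalStrip mu lam then
        x (Fin.last m) ^ (lam.card - mu.card) * schur mu (fun i => x i.castSucc) else 0 := by
  rw [← Finset.sum_filter, schur]
  rw [← Finset.sum_fiberwise_of_maps_to
    (t := (boxDiagrams n k).filter fun mu => IsHorizontalStrip mu lam)
    (g := fun T : BoundedSSYT lam (m + 1) => T.shapeBelow m)]
  swap
  · intro T _
    have h := T.isHorizontalStrip_shapeBelow
    exact Finset.mem_filter.2 ⟨mem_boxDiagrams_of_le h.1 hl, h⟩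
  refine Finset.sum_congr rfl fun mu hmu => ?_
  have h := (Finset.mem_filter.1 hmu).2
  rw [schur, Finset.mul_sum]
  symm
  refine Finset.sum_bij (fun T _ => T.extend h) ?_ ?_ ?_ ?_
  · intro T _
    simp [BoundedSSYT.shapeBelow_extend]
  · intro T _ T' _ he
    exact BoundedSSYT.extend_injective h he
  · intro T hT
    obtain ⟨T', hT'⟩ := BoundedSSYT.exists_extend_eq h T (Finset.mem_filter.1 hT).2
    exact ⟨T', Finset.mem_univ _, hT'⟩
  · intro T _
    rw [Fin.prod_univ_castSucc, BoundedSSYT.weight_extend_last]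
    simp only [BoundedSSYT.weight_extend_castSucc]
    ring

theorem schur_fin_zero (lam : YoungDiagram) (x : Fin 0 → ℝ) [Decidable (lam = ⊥)] :
    schur lam x = if lam = ⊥ then 1 else 0 := by
  unfold schur
  split_ifs with h
  · subst h
    have : Unique (BoundedSSYT ⊥ 0) :=
      { default := ⟨default, by simp⟩
        uniq := by
          intro T
          apply Subtype.ext
          ext i j
          rw [SemistandardYoungTableau.zeros _ (YoungDiagram.notMem_bot _),
            SemistandardYoungTableau.zeros _ (YoungDiagram.notMem_bot _)] }
    simp
  · have hne : lam.cells.Nonempty := by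
      rw [Finset.nonempty_iff_ne_empty]
      intro he
      exact h (YoungDiagram.ext (by simpa using he))
    obtain ⟨c, hc⟩ := hne
    have : IsEmpty (BoundedSSYT lam 0) := ⟨fun T => absurd (T.2 c hc) (Nat.not_lt_zero _)⟩
    simp

/-! ### Complete and elementary symmetric sequences -/

/-- Extension of a sequence by `0` to negative indices. -/
def extendZ (u : ℕ → ℂ) (r : ℤ) : ℂ := if 0 ≤ r then u r.toNat else 0

theorem extendZ_natCast (u : ℕ → ℂ) (p : ℕ) : extendZ u p = u p := by simp [extendZ]

theorem extendZ_of_neg (u : ℕ → ℂ) {r : ℤ} (hr : r < 0) : extendZ u r = 0 := by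
  simp [extendZ, hr]

/-- The generating series `∏ 1 / (1 - x_i X)` of the complete symmetric polynomials. -/
def hSeries {m : ℕ} (x : Fin m → ℂ) : PowerSeries ℂ := ∏ i, PowerSeries.mk fun p => x i ^ p

/-- The polynomial `∏ (1 + y_j X)`, whose coefficients are elementary symmetric polynomials. -/
def ePoly {m : ℕ} (y : Fin m → ℂ) : Polynomial ℂ :=
  ∏ j, (1 + Polynomial.C (y j) * Polynomial.X)

/-- The complete symmetric polynomials, indexed by `ℤ`. -/
def hZ {m : ℕ} (x : Fin m → ℂ) (r : ℤ) : ℂ := extendZ (fun p => PowerSeries.coeff p (hSeries x)) r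

/-- The elementary symmetric polynomials, indexed by `ℤ`. -/
def eZ {m : ℕ} (y : Fin m → ℂ) (r : ℤ) : ℂ := extendZ (fun p => (ePoly y).coeff p) r

theorem one_sub_mul_geometric (t : ℂ) :
    (1 - PowerSeries.C t * PowerSeries.X) * (PowerSeries.mk fun p => t ^ p) = 1 := by
  ext p
  rw [sub_mul, one_mul, map_sub, mul_assoc, PowerSeries.coeff_C_mul]
  cases p with
  | zero => simp
  | succ p =>
    rw [PowerSeries.coeff_succ_X_mul, PowerSeries.coeff_mk, PowerSeries.coeff_mk,
      PowerSeries.coeff_one]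
    simp [pow_succ, mul_comm]

theorem hZ_of_neg {m : ℕ} (x : Fin m → ℂ) {r : ℤ} (hr : r < 0) : hZ x r = 0 := extendZ_of_neg _ hr

theorem eZ_of_neg {m : ℕ} (y : Fin m → ℂ) {r : ℤ} (hr : r < 0) : eZ y r = 0 := extendZ_of_neg _ hr

theorem hZ_zero {m : ℕ} (x : Fin m → ℂ) : hZ x 0 = 1 := by
  rw [hZ, ← Nat.cast_zero, extendZ_natCast, hSeries, PowerSeries.coeff_zero_eq_constantCoeff,
    map_prod]
  exact Finset.prod_eq_one fun i _ => by
    rw [← PowerSeries.coeff_zero_eq_constantCoeff_apply, PowerSeries.coeff_mk, pow_zero]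

theorem hZ_fin_zero (x : Fin 0 → ℂ) (r : ℤ) : hZ x r = if r = 0 then 1 else 0 := by
  rcases lt_or_ge r 0 with h | h
  · rw [hZ_of_neg x h, if_neg h.ne]
  · obtain ⟨p, rfl⟩ := Int.eq_ofNat_of_zero_le h
    rw [hZ, extendZ_natCast]
    simp [hSeries, PowerSeries.coeff_one]

theorem eZ_fin_zero (y : Fin 0 → ℂ) (r : ℤ) : eZ y r = if r = 0 then 1 else 0 := by
  rcases lt_or_ge r 0 with h | h
  · rw [eZ_of_neg y h, if_neg h.ne]
  · obtain ⟨p, rfl⟩ := Int.eq_ofNat_of_zero_le h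
    rw [eZ, extendZ_natCast]
    simp [ePoly, Polynomial.coeff_one]

theorem hZ_succ {m : ℕ} (x : Fin (m + 1) → ℂ) (r : ℤ) :
    hZ x r = hZ (fun i => x i.castSucc) r + x (Fin.last m) * hZ x (r - 1) := by
  have hs : hSeries x = hSeries (fun i => x i.castSucc) +
      PowerSeries.C (x (Fin.last m)) * (PowerSeries.X * hSeries x) := by
    have h := one_sub_mul_geometric (x (Fin.last m))
    have hp : hSeries x = hSeries (fun i => x i.castSucc) *
        PowerSeries.mk fun p => x (Fin.last m) ^ p := Fin.prod_univ_castSucc _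
    rw [hp]
    linear_combination (hSeries fun i => x i.castSucc) * h
  rcases lt_or_ge r 0 with h | h
  · rw [hZ_of_neg x h, hZ_of_neg _ h, hZ_of_neg x (by omega)]
    simp
  · obtain ⟨p, rfl⟩ := Int.eq_ofNat_of_zero_le h
    rw [hZ, hZ, extendZ_natCast, extendZ_natCast]
    have h2 := congrArg (PowerSeries.coeff p) hs
    rw [map_add, PowerSeries.coeff_C_mul] at h2
    rw [h2]
    cases p with
    | zero => rw [hZ_of_neg x (by simp)]; simp
    | succ p =>
      rw [PowerSeries.coeff_succ_X_mul, hZ]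
      have : ((p + 1 : ℕ) : ℤ) - 1 = (p : ℤ) := by push_cast; ring
      rw [this, extendZ_natCast]

theorem ePoly_succ {m : ℕ} (y : Fin (m + 1) → ℂ) : ePoly y = ePoly (fun i => y i.castSucc) +
    Polynomial.C (y (Fin.last m)) * (Polynomial.X * ePoly (fun i => y i.castSucc)) := by
  have h : ePoly y = ePoly (fun i => y i.castSucc) *
      (1 + Polynomial.C (y (Fin.last m)) * Polynomial.X) := Fin.prod_univ_castSucc _
  rw [h]
  ring

theorem eZ_succ {m : ℕ} (y : Fin (m + 1) → ℂ) (r : ℤ) :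
    eZ y r = eZ (fun i => y i.castSucc) r + y (Fin.last m) * eZ (fun i => y i.castSucc) (r - 1) := by
  rcases lt_or_ge r 0 with h | h
  · rw [eZ_of_neg y h, eZ_of_neg _ h, eZ_of_neg _ (by omega)]
    simp
  · obtain ⟨p, rfl⟩ := Int.eq_ofNat_of_zero_le h
    rw [eZ, eZ, extendZ_natCast, extendZ_natCast, ePoly_succ, Polynomial.coeff_add, Polynomial.coeff_C_mul]
    cases p with
    | zero => rw [eZ_of_neg _ (by simp)]; simp
    | succ p =>
      rw [Polynomial.coeff_X_mul, eZ]
      have : ((p + 1 : ℕ) : ℤ) - 1 = (p : ℤ) := by push_cast; ring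
      rw [this, extendZ_natCast]

theorem natDegree_ePoly_le {m : ℕ} (y : Fin m → ℂ) : (ePoly y).natDegree ≤ m := by
  refine (Polynomial.natDegree_prod_le _ _).trans ?_
  calc ∑ j : Fin m, (1 + Polynomial.C (y j) * Polynomial.X).natDegree
      ≤ ∑ _j : Fin m, 1 := by
        refine Finset.sum_le_sum fun j _ => ?_
        rw [add_comm, ← Polynomial.C_1]
        exact Polynomial.natDegree_linear_le
    _ = m := by simp

theorem eZ_of_gt {m : ℕ} (y : Fin m → ℂ) {r : ℤ} (hr : (m : ℤ) < r) : eZ y r = 0 := by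
  obtain ⟨p, rfl⟩ := Int.eq_ofNat_of_zero_le (show 0 ≤ r by omega)
  rw [eZ, extendZ_natCast]
  exact Polynomial.coeff_eq_zero_of_natDegree_lt
    (lt_of_le_of_lt (natDegree_ePoly_le y) (by exact_mod_cast hr))

/-- Iterate `hZ_succ`. The sum may stop at L because the next index, L - 1 + r, is already negative.
-/
theorem hZ_succ_eq_sum {m : ℕ} (x : Fin (m + 1) → ℂ) (L : ℤ) {r : ℤ} (hr : L + r ≤ 0) {a : ℤ}
    (ha : L - 1 ≤ a) : hZ x (a + r) = ∑ b ∈ Finset.Icc L a,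
      x (Fin.last m) ^ (a - b).toNat * hZ (fun i => x i.castSucc) (b + r) := by
  induction a, ha using Int.leInduction with
  | base => rw [Finset.Icc_eq_empty (by omega), Finset.sum_empty, hZ_of_neg x (by omega)]
  | succ a ha ih =>
    have hI : Finset.Icc L (a + 1) = insert (a + 1) (Finset.Icc L a) := by
      ext b
      simp only [Finset.mem_Icc, Finset.mem_insert]
      omega
    rw [hI, Finset.sum_insert (by simp), hZ_succ]
    have e : a + 1 + r - 1 = a + r := by ring
    rw [e, ih, Finset.mul_sum]
    congr 1
    · simp
    · refine Finset.sum_congr rfl fun b hb => ?_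
      have : (a + 1 - b).toNat = (a - b).toNat + 1 := by
        have := (Finset.mem_Icc.1 hb).2
        omega
      rw [this, pow_succ]
      ring

/-! ### Minors of one-variable transfer matrices -/

theorem det_eq_mul_of_column_zero {R : Type*} [CommRing R] {N : ℕ}
    (A : Matrix (Fin (N + 1)) (Fin (N + 1)) R) (h : ∀ i : Fin N, A i.succ 0 = 0) :
    A.det = A 0 0 * (A.submatrix Fin.succ Fin.succ).det := by
  rw [Matrix.det_succ_column_zero, Fin.sum_univ_succ]
  rw [Finset.sum_eq_zero fun i _ => by rw [h i]; ring]
  simp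

theorem det_eq_mul_of_row_zero {R : Type*} [CommRing R] {N : ℕ}
    (A : Matrix (Fin (N + 1)) (Fin (N + 1)) R) (h : ∀ i : Fin N, A 0 i.succ = 0) :
    A.det = A 0 0 * (A.submatrix Fin.succ Fin.succ).det := by
  rw [← Matrix.det_transpose, det_eq_mul_of_column_zero _ h, ← Matrix.det_transpose]
  rfl

-- The minor sees only the interlacing a_0 ≥ b_0 > a_1 ≥ b_1 > …, which in coordinates is the
-- horizontal strip condition. If b_0 > a_0, the first column vanishes. If every later a lies below
-- b_0, the first column has one possibly nonzero entry and induction applies. Otherwise two rows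
-- are proportional.
open Classical in
theorem det_geometric_minor (t : ℂ) {N : ℕ} (a b : Fin N → ℤ) (ha : StrictAnti a)
    (hb : StrictAnti b) :
    Matrix.det (Matrix.of fun i j : Fin N => if b j ≤ a i then t ^ (a i - b j).toNat else 0) =
      if (∀ i, b i ≤ a i) ∧ ∀ i i', i < i' → a i' < b i then ∏ i, t ^ (a i - b i).toNat else 0 := by
  induction N with
  | zero => simp
  | succ N ih =>
    by_cases h1 : b 0 ≤ a 0
    swap
    · rw [if_neg (fun h => h1 (h.1 0))]
      refine Matrix.det_eq_zero_of_column_eq_zero 0 fun i => ?_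
      have : a i ≤ a 0 := ha.antitone (Fin.zero_le i)
      simp only [Matrix.of_apply]
      rw [if_neg (by omega)]
    by_cases h2 : ∀ i : Fin N, a i.succ < b 0
    · rw [det_eq_mul_of_column_zero]
      swap
      · intro i
        have := h2 i
        simp only [Matrix.of_apply]
        rw [if_neg (by omega)]
      have ih' := ih (fun i => a i.succ) (fun i => b i.succ)
        (fun i j hij => ha (Fin.succ_lt_succ_iff.2 hij))
        (fun i j hij => hb (Fin.succ_lt_succ_iff.2 hij))
      have e : (Matrix.of fun i j : Fin (N + 1) =>
          if b j ≤ a i then t ^ (a i - b j).toNat else 0).submatrix Fin.succ Fin.succ =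
          Matrix.of fun i j : Fin N =>
            if b j.succ ≤ a i.succ then t ^ (a i.succ - b j.succ).toNat else 0 := rfl
      rw [e, ih', Fin.prod_univ_succ]
      simp only [Matrix.of_apply, h1, if_true]
      have hiff : ((∀ i : Fin N, b i.succ ≤ a i.succ) ∧
          ∀ i i' : Fin N, i < i' → a i'.succ < b i.succ) ↔
          ((∀ i, b i ≤ a i) ∧ ∀ i i', i < i' → a i' < b i) := by
        simp only [Fin.forall_fin_succ, h1, true_and, Fin.not_lt_zero,
          false_implies, Fin.succ_pos, forall_true_left, Fin.succ_lt_succ_iff]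
        constructor
        · rintro ⟨h3, h4⟩
          exact ⟨h3, h2, fun i => h4 i⟩
        · rintro ⟨h3, _, h4⟩
          exact ⟨h3, fun i => h4 i⟩
      by_cases hc : (∀ i, b i ≤ a i) ∧ ∀ i i', i < i' → a i' < b i
      · rw [if_pos hc, if_pos (hiff.2 hc)]
      · rw [if_neg hc, if_neg (fun h => hc (hiff.1 h)), mul_zero]
    · rw [if_neg (fun h => h2 fun i => h.2 0 i.succ (Fin.succ_pos i))]
      push Not at h2
      obtain ⟨i, hi⟩ := h2
      have hai : a i.succ < a 0 := ha (Fin.succ_pos i)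
      -- Since a_{i+1} ≥ b_0 ≥ b_q for every q, no entry of rows 0 and i+1 is cut off, so row 0 is a
      -- power of t times row i+1.
      have hrow : (Matrix.of fun i j : Fin (N + 1) =>
          if b j ≤ a i then t ^ (a i - b j).toNat else 0) =
          (Matrix.of fun i j : Fin (N + 1) =>
            if b j ≤ a i then t ^ (a i - b j).toNat else 0).updateRow 0
            (t ^ (a 0 - a i.succ).toNat • fun j =>
              if b j ≤ a i.succ then t ^ (a i.succ - b j).toNat else 0) := by
        ext p q
        by_cases hp : p = 0
        · subst hp
          have hq : b q ≤ b 0 := hb.antitone (Fin.zero_le q)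
          rw [Matrix.updateRow_self]
          simp only [Matrix.of_apply, Pi.smul_apply, smul_eq_mul]
          rw [if_pos (by omega), if_pos (by omega), ← pow_add]
          congr 1
          omega
        · rw [Matrix.updateRow_ne hp]
      rw [hrow, Matrix.det_updateRow_smul]
      have hz : ((Matrix.of fun i j : Fin (N + 1) =>
            if b j ≤ a i then t ^ (a i - b j).toNat else 0).updateRow 0
            fun j => if b j ≤ a i.succ then t ^ (a i.succ - b j).toNat else 0).det = 0 := by
        refine Matrix.det_zero_of_row_eq (Fin.succ_ne_zero i).symm ?_
        rw [Matrix.updateRow_self, Matrix.updateRow_ne (Fin.succ_ne_zero i)]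
        rfl
      rw [hz, mul_zero]

-- The bidiagonal counterpart for vertical strips: each a_i - b_i must be 0 or 1. If a_0 = b_0 the
-- first column is zero below its top entry; if a_0 = b_0 + 1 the first row is zero to the right of
-- its first entry.
open Classical in
theorem det_linear_minor (t : ℂ) {N : ℕ} (a b : Fin N → ℤ) (ha : StrictAnti a)
    (hb : StrictAnti b) :
    Matrix.det (Matrix.of fun i j : Fin N =>
        if b j = a i then 1 else if b j = a i - 1 then t else 0) =
      if ∀ i, b i ≤ a i ∧ a i ≤ b i + 1 then ∏ i, t ^ (a i - b i).toNat else 0 := by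
  induction N with
  | zero => simp
  | succ N ih =>
    have ha0 : ∀ i : Fin N, a i.succ < a 0 := fun i => ha (Fin.succ_pos i)
    have hb0 : ∀ i : Fin N, b i.succ < b 0 := fun i => hb (Fin.succ_pos i)
    by_cases h1 : b 0 ≤ a 0 ∧ a 0 ≤ b 0 + 1
    swap
    · rw [if_neg (fun h => h1 (h 0))]
      rcases lt_or_ge (a 0) (b 0) with h2 | h2
      · refine Matrix.det_eq_zero_of_column_eq_zero 0 fun i => ?_
        have : a i ≤ a 0 := ha.antitone (Fin.zero_le i)
        simp only [Matrix.of_apply]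
        rw [if_neg (by omega), if_neg (by omega)]
      · refine Matrix.det_eq_zero_of_row_eq_zero 0 fun i => ?_
        have : b i ≤ b 0 := hb.antitone (Fin.zero_le i)
        simp only [Matrix.of_apply]
        rw [if_neg (by omega), if_neg (by omega)]
    have ih' := ih (fun i => a i.succ) (fun i => b i.succ)
      (fun i j hij => ha (Fin.succ_lt_succ_iff.2 hij))
      (fun i j hij => hb (Fin.succ_lt_succ_iff.2 hij))
    have e : (Matrix.of fun i j : Fin (N + 1) =>
        if b j = a i then 1 else if b j = a i - 1 then t else 0).submatrix Fin.succ Fin.succ =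
        Matrix.of fun i j : Fin N =>
          if b j.succ = a i.succ then 1 else if b j.succ = a i.succ - 1 then t else 0 := rfl
    have hd : Matrix.det (Matrix.of fun i j : Fin (N + 1) =>
        if b j = a i then 1 else if b j = a i - 1 then t else 0) =
        t ^ (a 0 - b 0).toNat * Matrix.det (Matrix.of fun i j : Fin N =>
          if b j.succ = a i.succ then 1 else if b j.succ = a i.succ - 1 then t else 0) := by
      rcases eq_or_ne (a 0) (b 0) with h2 | h2
      · rw [det_eq_mul_of_column_zero, e]
        · simp [h2]
        · intro i
          have := ha0 i
          simp only [Matrix.of_apply]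
          rw [if_neg (by omega), if_neg (by omega)]
      · rw [det_eq_mul_of_row_zero, e]
        · have h3 : a 0 = b 0 + 1 := by omega
          simp [h3]
        · intro i
          have := hb0 i
          simp only [Matrix.of_apply]
          rw [if_neg (by omega), if_neg (by omega)]
    rw [hd, ih', Fin.prod_univ_succ]
    by_cases hc : ∀ i, b i ≤ a i ∧ a i ≤ b i + 1
    · rw [if_pos hc, if_pos (fun i : Fin N => hc i.succ)]
    · rw [if_neg hc, if_neg (fun h => hc (Fin.cases h1 h)), mul_zero]

/-! ### The Jacobi–Trudi formulas -/

theorem coord_bot (i : ℕ) : coord ⊥ i = -i := by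
  have : (⊥ : YoungDiagram).rowLen i = 0 := by
    by_contra! h
    exact YoungDiagram.notMem_bot _ (YoungDiagram.mem_iff_lt_rowLen.2 (Nat.pos_of_ne_zero h))
  simp [coord, this]

/-- The case of no variables in both Jacobi–Trudi formulas: a nonempty diagram has a positive first
row, which makes row 0 of the matrix vanish. -/
theorem det_delta_coord {N k : ℕ} {lam : YoungDiagram} (hl : lam ∈ boxDiagrams N k)
    [Decidable (lam = ⊥)] :
    Matrix.det (Matrix.of fun i j : Fin N => if coord lam i + j = 0 then (1 : ℂ) else 0) =
      if lam = ⊥ then 1 else 0 := by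
  split_ifs with h
  · subst h
    have e : (Matrix.of fun i j : Fin N => if coord ⊥ i + j = 0 then (1 : ℂ) else 0) = 1 := by
      ext i j
      have hiff : coord ⊥ i + j = 0 ↔ i = j := by
        rw [coord_bot, Fin.ext_iff]
        omega
      simp only [Matrix.of_apply, hiff, Matrix.one_apply]
    rw [e, Matrix.det_one]
  · have hne : lam.cells.Nonempty := by
      rw [Finset.nonempty_iff_ne_empty]
      intro he
      exact h (YoungDiagram.ext (by simpa using he))
    obtain ⟨⟨p, q⟩, hc⟩ := hne
    have hc' : (p, q) ∈ lam := hc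
    have hN := (mem_boxDiagrams.1 hl p q hc').1
    have h0 : (0, 0) ∈ lam := lam.up_left_mem (Nat.zero_le _) (Nat.zero_le _) hc'
    have h1 := YoungDiagram.mem_iff_lt_rowLen.1 h0
    refine Matrix.det_eq_zero_of_row_eq_zero ⟨0, by omega⟩ fun j => ?_
    have h2 : coord lam (0 : ℕ) + j ≠ 0 := by
      simp only [coord]
      omega
    simp only [Matrix.of_apply, h2, if_false]

theorem card_eq_sum_rowLen {N k : ℕ} {lam : YoungDiagram} (hl : lam ∈ boxDiagrams N k) :
    lam.card = ∑ i : Fin N, lam.rowLen i := by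
  rw [YoungDiagram.card, Finset.card_eq_sum_card_fiberwise (f := Prod.fst)
    (t := Finset.range N) (fun c hc => Finset.mem_coe.2 (Finset.mem_range.2
      (mem_boxDiagrams.1 hl c.1 c.2 hc).1)), Finset.sum_range]
  refine Finset.sum_congr rfl fun i _ => ?_
  rw [YoungDiagram.rowLen_eq_card]
  rfl

theorem sum_toNat_coord_sub {N k : ℕ} {lam mu : YoungDiagram} (hl : lam ∈ boxDiagrams N k)
    (hm : mu ∈ boxDiagrams N k) (h : ∀ i : Fin N, coord mu i ≤ coord lam i) :
    ∑ i : Fin N, (coord lam i - coord mu i).toNat = lam.card - mu.card := by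
  rw [card_eq_sum_rowLen hl, card_eq_sum_rowLen hm, eq_tsub_iff_add_eq_of_le, ← Finset.sum_add_distrib]
  · refine Finset.sum_congr rfl fun i _ => ?_
    have := h i
    simp only [coord] at this ⊢
    omega
  · refine Finset.sum_le_sum fun i _ => ?_
    have := h i
    simp only [coord] at this
    omega

theorem isHorizontalStrip_iff_coord {N k : ℕ} {lam mu : YoungDiagram} (hl : lam ∈ boxDiagrams N k) :
    IsHorizontalStrip mu lam ∧ mu ∈ boxDiagrams N k ↔ mu ∈ boxDiagrams N k ∧
      (∀ i : Fin N, coord mu i ≤ coord lam i) ∧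
      ∀ i i' : Fin N, i < i' → coord lam i' < coord mu i := by
  constructor
  · rintro ⟨⟨h1, h2⟩, hm⟩
    have hr : ∀ i, mu.rowLen i ≤ lam.rowLen i := by
      intro i
      by_contra! hlt
      have := h1 (YoungDiagram.mem_iff_lt_rowLen.2 hlt)
      exact lt_irrefl _ (YoungDiagram.mem_iff_lt_rowLen.1 this)
    have hr' : ∀ i, lam.rowLen (i + 1) ≤ mu.rowLen i := by
      intro i
      by_contra! hlt
      have := h2 i _ (YoungDiagram.mem_iff_lt_rowLen.2 hlt)
      exact lt_irrefl _ (YoungDiagram.mem_iff_lt_rowLen.1 this)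
    refine ⟨hm, fun i => ?_, fun i i' hi => ?_⟩
    · have := hr i
      simp only [coord]
      omega
    · have h3 := hr' i
      have hi' : (i : ℕ) < i' := hi
      have h4 := lam.rowLen_anti (i + 1) i' hi'
      simp only [coord]
      omega
  · rintro ⟨hm, h1, h2⟩
    refine ⟨⟨?_, ?_⟩, hm⟩
    · rintro ⟨i, j⟩ hij
      have hi := (mem_boxDiagrams.1 hm i j hij).1
      have h3 := h1 ⟨i, hi⟩
      have h4 := YoungDiagram.mem_iff_lt_rowLen.1 hij
      simp only [coord] at h3
      exact YoungDiagram.mem_iff_lt_rowLen.2 (by omega)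
    · intro i j hij
      have hi := (mem_boxDiagrams.1 hl _ _ hij).1
      have h3 := h2 ⟨i, by omega⟩ ⟨i + 1, hi⟩ (by simp [Fin.lt_def])
      have h4 := YoungDiagram.mem_iff_lt_rowLen.1 hij
      simp only [coord] at h3
      exact YoungDiagram.mem_iff_lt_rowLen.2 (by push_cast at h3; omega)

theorem isHorizontalStrip_transpose_iff_coord {N k : ℕ} {lam mu : YoungDiagram}
    (hl : lam ∈ boxDiagrams N k) :
    IsHorizontalStrip mu.transpose lam.transpose ∧ mu ∈ boxDiagrams N k ↔ mu ∈ boxDiagrams N k ∧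
      ∀ i : Fin N, coord mu i ≤ coord lam i ∧ coord lam i ≤ coord mu i + 1 := by
  have hT : ∀ (nu : YoungDiagram) i j, (i, j) ∈ nu.transpose ↔ (j, i) ∈ nu := by
    intro nu i j
    rw [YoungDiagram.mem_transpose]
    rfl
  constructor
  · rintro ⟨⟨h1, h2⟩, hm⟩
    have h1' := YoungDiagram.transpose_le_iff.1 h1
    refine ⟨hm, fun i => ?_⟩
    have hr : mu.rowLen i ≤ lam.rowLen i := by
      by_contra! hlt
      have := h1' (YoungDiagram.mem_iff_lt_rowLen.2 hlt)
      exact lt_irrefl _ (YoungDiagram.mem_iff_lt_rowLen.1 this)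
    have hr' : lam.rowLen i ≤ mu.rowLen i + 1 := by
      by_contra! hlt
      have := h2 (mu.rowLen i) i ((hT _ _ _).2 (YoungDiagram.mem_iff_lt_rowLen.2 hlt))
      exact lt_irrefl _ (YoungDiagram.mem_iff_lt_rowLen.1 ((hT _ _ _).1 this))
    simp only [coord]
    omega
  · rintro ⟨hm, h1⟩
    refine ⟨⟨YoungDiagram.transpose_le_iff.2 ?_, ?_⟩, hm⟩
    · rintro ⟨i, j⟩ hij
      have hi := (mem_boxDiagrams.1 hm i j hij).1
      have h3 := h1 ⟨i, hi⟩
      have h4 := YoungDiagram.mem_iff_lt_rowLen.1 hij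
      simp only [coord] at h3
      exact YoungDiagram.mem_iff_lt_rowLen.2 (by omega)
    · intro j i hij
      rw [hT] at hij ⊢
      have hi := (mem_boxDiagrams.1 hl _ _ hij).1
      have h3 := h1 ⟨i, hi⟩
      have h4 := YoungDiagram.mem_iff_lt_rowLen.1 hij
      simp only [coord] at h3
      exact YoungDiagram.mem_iff_lt_rowLen.2 (by omega)

theorem transpose_mem_boxDiagrams {N k : ℕ} {lam : YoungDiagram} :
    lam.transpose ∈ boxDiagrams k N ↔ lam ∈ boxDiagrams N k := by
  simp only [mem_boxDiagrams, YoungDiagram.mem_transpose, Prod.swap_prod_mk]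
  exact ⟨fun h i j hij => (h j i hij).symm, fun h i j hij => (h j i hij).symm⟩

theorem coord_strictAnti_fin (lam : YoungDiagram) (N : ℕ) :
    StrictAnti fun i : Fin N => coord lam i :=
  fun _ _ hij => coord_strictAnti lam hij

/-- The Jacobi–Trudi formula. -/
theorem schur_eq_det_hZ {N k m : ℕ} (x : Fin m → ℝ) {lam : YoungDiagram}
    (hl : lam ∈ boxDiagrams N k) : (schur lam x : ℂ) =
      Matrix.det (Matrix.of fun i j : Fin N => hZ (fun p => (x p : ℂ)) (coord lam i + j)) := by
  classical
  induction m generalizing lam with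
  | zero =>
    simp only [hZ_fin_zero]
    rw [det_delta_coord hl, schur_fin_zero]
    split_ifs <;> simp
  | succ m ih =>
    have e : (Matrix.of fun i j : Fin N => hZ (fun p => (x p : ℂ)) (coord lam i + j)) =
        Matrix.of fun i j : Fin N => ∑ b ∈ Finset.Icc (1 - (N : ℤ)) k,
          (if b ≤ coord lam i then (x (Fin.last m) : ℂ) ^ (coord lam i - b).toNat else 0) *
            hZ (fun p : Fin m => (x p.castSucc : ℂ)) (b + j) := by
      ext i j
      have hj := j.2
      have hc := Finset.mem_Icc.1 (coord_mem_Icc hl i)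
      simp only [Matrix.of_apply, ite_mul, zero_mul]
      -- Cutting at 1 - N loses nothing: j ≤ N - 1 makes every earlier index negative.
      rw [hZ_succ_eq_sum _ (1 - (N : ℤ)) (by omega) (by omega), ← Finset.sum_filter]
      refine Finset.sum_congr ?_ fun _ _ => rfl
      ext b
      simp only [Finset.mem_Icc, Finset.mem_filter]
      omega
    rw [e, det_sum_mul_eq_sum_boxDiagrams N k
      (fun i b => if b ≤ coord lam i then (x (Fin.last m) : ℂ) ^ (coord lam i - b).toNat else 0)
      (fun j b => hZ (fun p : Fin m => (x p.castSucc : ℂ)) (b + j)), schur_succ hl]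
    push_cast
    refine Finset.sum_congr rfl fun mu hm => ?_
    rw [det_geometric_minor _ _ _ (coord_strictAnti_fin lam N) (coord_strictAnti_fin mu N)]
    have hiff := isHorizontalStrip_iff_coord (mu := mu) hl
    simp only [hm, and_true, true_and] at hiff
    by_cases hs : IsHorizontalStrip mu lam
    · rw [if_pos hs, if_pos (hiff.1 hs), Finset.prod_pow_eq_pow_sum,
        sum_toNat_coord_sub hl hm (hiff.1 hs).1, ← Matrix.det_transpose]
      push_cast
      rw [ih _ hm]
      rfl
    · rw [if_neg hs, if_neg (fun h => hs (hiff.2 h))]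
      simp

/-- The dual Jacobi–Trudi formula. -/
theorem schur_transpose_eq_det_eZ {N k m : ℕ} (y : Fin m → ℝ) {lam : YoungDiagram}
    (hl : lam ∈ boxDiagrams N k) : (schur lam.transpose y : ℂ) =
      Matrix.det (Matrix.of fun i j : Fin N => eZ (fun p => (y p : ℂ)) (coord lam i + j)) := by
  classical
  induction m generalizing lam with
  | zero =>
    simp only [eZ_fin_zero]
    have hb : lam.transpose = ⊥ ↔ lam = ⊥ := by
      have : (⊥ : YoungDiagram).transpose = ⊥ := rfl
      rw [YoungDiagram.transpose_eq_iff_eq_transpose, this]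
    rw [det_delta_coord hl, schur_fin_zero]
    simp only [hb]
    split_ifs <;> simp
  | succ m ih =>
    have e : (Matrix.of fun i j : Fin N => eZ (fun p => (y p : ℂ)) (coord lam i + j)) =
        Matrix.of fun i j : Fin N => ∑ b ∈ Finset.Icc (1 - (N : ℤ)) k,
          (if b = coord lam i then 1 else if b = coord lam i - 1 then (y (Fin.last m) : ℂ) else 0) *
            eZ (fun p : Fin m => (y p.castSucc : ℂ)) (b + j) := by
      ext i j
      have hj := j.2
      have hc := coord_mem_Icc hl i
      have hc' := Finset.mem_Icc.1 hc
      simp only [Matrix.of_apply]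
      have hsplit : ∀ b : ℤ, (if b = coord lam i then (1 : ℂ) else
          if b = coord lam i - 1 then (y (Fin.last m) : ℂ) else 0) =
          (if b = coord lam i then (1 : ℂ) else 0) +
            if b = coord lam i - 1 then (y (Fin.last m) : ℂ) else 0 := by
        intro b
        by_cases h : b = coord lam i
        · rw [if_pos h, if_pos h, if_neg (by omega), add_zero]
        · rw [if_neg h, if_neg h, zero_add]
      simp only [hsplit, add_mul, Finset.sum_add_distrib, ite_mul, one_mul, zero_mul,
        Finset.sum_ite_eq', hc, if_true]
      rw [eZ_succ]
      congr 1
      have e2 : coord lam i + j - 1 = coord lam i - 1 + j := by ring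
      -- The site below `coord lam i` can leave the window only at its lower end, where the index of
      -- the elementary polynomial is negative.
      split_ifs with h
      · rw [e2]
      · rw [Finset.mem_Icc] at h
        rw [eZ_of_neg _ (by omega), mul_zero]
    rw [e, det_sum_mul_eq_sum_boxDiagrams N k
      (fun i b => if b = coord lam i then 1 else
        if b = coord lam i - 1 then (y (Fin.last m) : ℂ) else 0)
      (fun j b => eZ (fun p : Fin m => (y p.castSucc : ℂ)) (b + j)),
      schur_succ (transpose_mem_boxDiagrams.2 hl)]
    push_cast
    refine Finset.sum_bij (fun mu _ => mu.transpose)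
      (fun mu hm => transpose_mem_boxDiagrams.2 hm)
      (fun mu _ nu _ h => YoungDiagram.transpose_eq_iff.1 h)
      (fun mu hm => ⟨mu.transpose, transpose_mem_boxDiagrams.2 hm, by simp⟩) fun mu' hm' => ?_
    obtain ⟨mu, rfl⟩ : ∃ mu : YoungDiagram, mu' = mu.transpose := ⟨mu'.transpose, by simp⟩
    have hm : mu ∈ boxDiagrams N k := transpose_mem_boxDiagrams.1 hm'
    rw [YoungDiagram.transpose_transpose]
    rw [det_linear_minor _ _ _ (coord_strictAnti_fin lam N) (coord_strictAnti_fin mu N)]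
    have hiff := isHorizontalStrip_transpose_iff_coord (mu := mu) hl
    simp only [hm, and_true, true_and] at hiff
    have hcard : ∀ nu : YoungDiagram, nu.transpose.card = nu.card := fun nu => by
      simp [YoungDiagram.card, YoungDiagram.transpose]
    by_cases hs : IsHorizontalStrip mu.transpose lam.transpose
    · rw [if_pos hs, if_pos (hiff.1 hs), Finset.prod_pow_eq_pow_sum,
        sum_toNat_coord_sub hl hm (fun i => (hiff.1 hs i).1), ← Matrix.det_transpose, hcard, hcard]
      push_cast
      rw [ih _ hm]
      rfl
    · rw [if_neg hs, if_neg (fun h => hs (hiff.2 h))]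
      simp

/-! ### Linear recurrences -/

/-- Multiplication by a polynomial is a finite convolution on coefficients; the extension by zero
keeps this valid at every integer index. -/
theorem sum_coeff_mul_extendZ {P F : PowerSeries ℂ} {N : ℕ}
    (hP : ∀ i, N ≤ i → PowerSeries.coeff i P = 0) (r : ℤ) :
    ∑ i ∈ Finset.range N, PowerSeries.coeff i P * extendZ (fun p => PowerSeries.coeff p F) (r - i) =
      extendZ (fun p => PowerSeries.coeff p (P * F)) r := by
  rcases lt_or_ge r 0 with h | h
  · rw [extendZ_of_neg _ h]
    exact Finset.sum_eq_zero fun i _ => by rw [extendZ_of_neg _ (by omega), mul_zero]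
  · obtain ⟨p, rfl⟩ := Int.eq_ofNat_of_zero_le h
    rw [extendZ_natCast, PowerSeries.coeff_mul, Finset.Nat.sum_antidiagonal_eq_sum_range_succ
      (fun i j => PowerSeries.coeff i P * PowerSeries.coeff j F)]
    have h1 : ∑ i ∈ Finset.range (p + 1), PowerSeries.coeff i P * PowerSeries.coeff (p - i) F =
        ∑ i ∈ Finset.range (p + 1), PowerSeries.coeff i P *
          extendZ (fun p => PowerSeries.coeff p F) ((p : ℤ) - i) := by
      refine Finset.sum_congr rfl fun i hi => ?_
      have : i ≤ p := by have := Finset.mem_range.1 hi; omega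
      rw [← Nat.cast_sub this, extendZ_natCast]
    rw [h1, Finset.sum_subset (s₂ := Finset.range (N + p + 1)),
      Finset.sum_subset (s₁ := Finset.range (p + 1)) (s₂ := Finset.range (N + p + 1))]
    · intro i hi
      simp only [Finset.mem_range] at hi ⊢
      omega
    · intro i _ hi
      simp only [Finset.mem_range] at hi
      rw [extendZ_of_neg _ (by omega), mul_zero]
    · intro i hi
      simp only [Finset.mem_range] at hi ⊢
      omega
    · intro i _ hi
      simp only [Finset.mem_range] at hi
      rw [hP i (by omega), zero_mul]

/-- The coefficients of `∏ (1 - x_i X)`. -/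
def signedE {n : ℕ} (x : Fin n → ℂ) (i : ℕ) : ℂ := (ePoly fun p => -x p).coeff i

theorem signedE_of_gt {n : ℕ} (x : Fin n → ℂ) {i : ℕ} (hi : n < i) : signedE x i = 0 :=
  Polynomial.coeff_eq_zero_of_natDegree_lt (lt_of_le_of_lt (natDegree_ePoly_le _) hi)

theorem signedE_zero {n : ℕ} (x : Fin n → ℂ) : signedE x 0 = 1 := by
  simp [signedE, ePoly, Polynomial.coeff_zero_eq_eval_zero, Polynomial.eval_prod]

theorem ePoly_neg_mul_hSeries {n : ℕ} (x : Fin n → ℂ) :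
    ((ePoly fun p => -x p : Polynomial ℂ) : PowerSeries ℂ) * hSeries x = 1 := by
  have h : ((ePoly fun p => -x p : Polynomial ℂ) : PowerSeries ℂ) =
      ∏ i, (1 - PowerSeries.C (x i) * PowerSeries.X) := by
    rw [ePoly, ← Polynomial.coeToPowerSeries.ringHom_apply, map_prod]
    refine Finset.prod_congr rfl fun i _ => ?_
    simp [sub_eq_add_neg]
  rw [h, hSeries, ← Finset.prod_mul_distrib]
  exact Finset.prod_eq_one fun i _ => one_sub_mul_geometric _

/-- `∏ (1 - x_i S) u` at `a`, where `S` is the shift of two-sided sequences. -/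
def recurrence {n : ℕ} (x : Fin n → ℂ) (u : ℤ → ℂ) (a : ℤ) : ℂ :=
  ∑ i ∈ Finset.range (n + 1), signedE x i * u (a - i)

theorem recurrence_hZ {n : ℕ} (x : Fin n → ℂ) (r : ℤ) :
    recurrence x (hZ x) r = if r = 0 then 1 else 0 := by
  have h := sum_coeff_mul_extendZ (P := ((ePoly fun p => -x p : Polynomial ℂ) : PowerSeries ℂ))
    (F := hSeries x) (N := n + 1) (fun i hi => by
      rw [Polynomial.coeff_coe]; exact signedE_of_gt x hi) r
  rw [ePoly_neg_mul_hSeries] at h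
  simp only [Polynomial.coeff_coe] at h
  refine h.trans ?_
  rcases lt_or_ge r 0 with h0 | h0
  · rw [extendZ_of_neg _ h0, if_neg h0.ne]
  · obtain ⟨p, rfl⟩ := Int.eq_ofNat_of_zero_le h0
    rw [extendZ_natCast]
    simp [PowerSeries.coeff_one]

/-- Solutions of the recurrence on the positive half-line are combinations of shifts of the
complete symmetric sequence. -/
theorem exists_eq_sum_hZ {n : ℕ} (x : Fin n → ℂ) (u : ℤ → ℂ)
    (hu : ∀ a, 1 ≤ a → recurrence x u a = 0) :
    ∃ q : Fin n → ℂ, ∀ M : ℤ, -(n : ℤ) < M → u M = ∑ j : Fin n, hZ x (M + j) * q j := by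
  -- The series starts at u(1 - n), so the n initial values u(1 - n), …, u(0) occupy degrees below
  -- n. The recurrence then says that E Φ is a polynomial of degree less than n, and dividing by E
  -- expresses Φ through `hSeries`.
  let Φ : PowerSeries ℂ := PowerSeries.mk fun s => u ((s : ℤ) + 1 - n)
  let E : PowerSeries ℂ := ((ePoly fun p => -x p : Polynomial ℂ) : PowerSeries ℂ)
  have hE : E * hSeries x = 1 := ePoly_neg_mul_hSeries x
  have hz : ∀ s, n ≤ s → PowerSeries.coeff s (E * Φ) = 0 := by
    intro s hs
    have h := sum_coeff_mul_extendZ (P := E) (F := Φ) (N := n + 1) (fun i hi => by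
      rw [Polynomial.coeff_coe]; exact signedE_of_gt x hi) s
    rw [extendZ_natCast] at h
    rw [← h, ← hu ((s : ℤ) + 1 - n) (by omega), recurrence]
    refine Finset.sum_congr rfl fun i hi => ?_
    have hi' := Finset.mem_range.1 hi
    rw [Polynomial.coeff_coe, ← Nat.cast_sub (by omega), extendZ_natCast, PowerSeries.coeff_mk,
      Nat.cast_sub (by omega)]
    congr 2
    ring
  refine ⟨fun j => PowerSeries.coeff (n - 1 - j) (E * Φ), fun M hM => ?_⟩
  have h := sum_coeff_mul_extendZ (P := E * Φ) (F := hSeries x) hz (M + n - 1)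
  have hΦ : E * Φ * hSeries x = Φ := by rw [mul_right_comm, hE, one_mul]
  rw [hΦ] at h
  obtain ⟨s, hs⟩ := Int.eq_ofNat_of_zero_le (show 0 ≤ M + n - 1 by omega)
  have hs' : extendZ (fun p => PowerSeries.coeff p Φ) (M + n - 1) = u M := by
    rw [hs, extendZ_natCast, PowerSeries.coeff_mk]
    congr 1
    have : (s : ℤ) = M + n - 1 := hs.symm
    omega
  rw [← hs', ← h, ← Finset.sum_range_reflect, Finset.sum_range]
  refine Finset.sum_congr rfl fun j _ => ?_
  have hj := j.2
  rw [mul_comm, hZ]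
  congr 2
  push_cast [Nat.cast_sub (show (j : ℕ) ≤ n - 1 by omega), Nat.cast_sub (show 1 ≤ n by omega)]
  ring

theorem exists_matrix_eq_sum_hZ {n : ℕ} (x : Fin n → ℂ) (u : ℤ → ℂ)
    (hu : ∀ a, 1 ≤ a → recurrence x u a = 0) :
    ∃ Q : Matrix (Fin n) (Fin n) ℂ, ∀ (M : ℤ) (t : Fin n), -(n : ℤ) < M →
      u (M + t) = ∑ j : Fin n, hZ x (M + j) * Q j t := by
  have h : ∀ t : Fin n, ∃ q : Fin n → ℂ, ∀ M : ℤ, -(n : ℤ) < M →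
      u (M + t) = ∑ j : Fin n, hZ x (M + j) * q j := by
    intro t
    refine exists_eq_sum_hZ x (fun a => u (a + t)) fun a ha => ?_
    rw [← hu (a + t) (by omega), recurrence, recurrence]
    refine Finset.sum_congr rfl fun i _ => ?_
    congr 2
    ring
  choose q hq using h
  exact ⟨Matrix.of fun j t => q t j, fun M t hM => hq t M hM⟩

theorem det_hZ_sub {n : ℕ} (x : Fin n → ℂ) :
    Matrix.det (Matrix.of fun i j : Fin n => hZ x ((j : ℤ) - i)) = 1 := by
  rw [Matrix.det_of_isUpperTriangular]
  · exact Finset.prod_eq_one fun i _ => by simp [hZ_zero]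
  · intro i j hij
    have : (j : ℕ) < i := hij
    exact hZ_of_neg x (by omega)

/-- Both u-matrices are an h-matrix times the same Q; for the rows M = -i the h-matrix is
unitriangular, which identifies det Q. -/
theorem det_eq_det_hZ_mul {n : ℕ} (x : Fin n → ℂ) (u : ℤ → ℂ)
    (hu : ∀ a, 1 ≤ a → recurrence x u a = 0) (a : Fin n → ℤ) (ha : ∀ i, -(n : ℤ) < a i) :
    Matrix.det (Matrix.of fun i t : Fin n => u (a i + t)) =
      Matrix.det (Matrix.of fun i j : Fin n => hZ x (a i + j)) *
        Matrix.det (Matrix.of fun i t : Fin n => u ((t : ℤ) - i)) := by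
  obtain ⟨Q, hQ⟩ := exists_matrix_eq_sum_hZ x u hu
  have h1 : ∀ b : Fin n → ℤ, (∀ i, -(n : ℤ) < b i) →
      (Matrix.of fun i t : Fin n => u (b i + t)) =
        (Matrix.of fun i j : Fin n => hZ x (b i + j)) * Q := by
    intro b hb
    ext i t
    rw [Matrix.mul_apply]
    exact hQ (b i) t (hb i)
  have h2 := h1 (fun i => -(i : ℤ)) (fun i => by have := i.2; omega)
  simp only [neg_add_eq_sub] at h2
  rw [h1 a ha, h2, Matrix.det_mul, Matrix.det_mul, det_hZ_sub, one_mul]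

/-- Removing a variable is a column operation: each column is the reduced one plus x_m times its
predecessor. The first column has a fictitious predecessor (t, 0, …, 0), which contributes the extra
term x_m t times a smaller determinant. The induction uses the sizes N + 1 and N together, hence the
free size. -/
theorem det_hZ_add_mul {m : ℕ} (x : Fin m → ℂ) (t : ℂ) {N : ℕ} (hN : m ≤ N) :
    Matrix.det (Matrix.of fun i j : Fin N => hZ x ((j : ℤ) - i) + t * hZ x ((j : ℤ) - i + 1)) =
      ∏ p, (1 + x p * t) := by
  induction m generalizing N with
  | zero =>
    rw [Matrix.det_of_isLowerTriangular]
    · simp [hZ_fin_zero]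
    · intro i j hij
      have : (i : ℕ) < j := hij
      simp only [Matrix.of_apply, hZ_fin_zero]
      rw [if_neg (by omega), if_neg (by omega)]
      simp
  | succ m ih =>
    obtain ⟨N, rfl⟩ : ∃ N', N = N' + 1 := ⟨N - 1, by omega⟩
    let x' : Fin m → ℂ := fun i => x i.castSucc
    let g : ℤ → ℂ := fun r => hZ x r + t * hZ x (r + 1)
    let g' : ℤ → ℂ := fun r => hZ x' r + t * hZ x' (r + 1)
    have hg : ∀ r, g r = g' r + x (Fin.last m) * g (r - 1) := by
      intro r
      simp only [g, g', x']
      rw [hZ_succ x r, hZ_succ x (r + 1)]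
      have e1 : r + 1 - 1 = r := by ring
      have e2 : r - 1 + 1 = r := by ring
      rw [e1, e2, hZ_succ x r]
      ring
    have hgneg : ∀ i : ℕ, g (-(i : ℤ) - 1) = if i = 0 then t else 0 := by
      intro i
      simp only [g]
      split_ifs with h
      · subst h
        rw [hZ_of_neg x (by simp)]
        simp [hZ_zero]
      · rw [hZ_of_neg x (by omega), hZ_of_neg x (by omega)]
        simp
    let B : Matrix (Fin (N + 1)) (Fin (N + 1)) ℂ := Matrix.of fun i j => g' ((j : ℤ) - i)
    have h1 : Matrix.det (Matrix.of fun i j : Fin (N + 1) => g ((j : ℤ) - i)) =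
        (B.updateCol 0 ((fun i : Fin (N + 1) => g' (-(i : ℤ))) +
          fun i : Fin (N + 1) => if (i : ℕ) = 0 then x (Fin.last m) * t else 0)).det := by
      refine Matrix.det_eq_of_forall_col_eq_smul_add_pred (fun _ => x (Fin.last m)) ?_ ?_
      · intro i
        rw [Matrix.updateCol_self]
        simp only [Matrix.of_apply, Pi.add_apply, Fin.val_zero, Nat.cast_zero, zero_sub]
        rw [hg, hgneg]
        split_ifs <;> simp
      · intro i j
        rw [Matrix.updateCol_ne (Fin.succ_ne_zero j)]
        simp only [B, Matrix.of_apply, Fin.val_succ, Fin.val_castSucc]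
        rw [hg]
        congr 3
        push_cast
        ring
    have h2 : (B.updateCol 0 fun i : Fin (N + 1) => g' (-(i : ℤ))) = B := by
      ext i j
      by_cases hj : j = 0
      · subst hj
        rw [Matrix.updateCol_self]
        simp [B]
      · rw [Matrix.updateCol_ne hj]
    change Matrix.det (Matrix.of fun i j : Fin (N + 1) => g ((j : ℤ) - i)) = _
    rw [h1, Matrix.det_updateCol_add, h2, ih x' (by omega), det_eq_mul_of_column_zero _ ?_,
      Matrix.updateCol_self]
    · have h3 : (B.updateCol 0 fun i => if (i : ℕ) = 0 then x (Fin.last m) * t else 0).submatrix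
          Fin.succ Fin.succ =
          Matrix.of fun i j : Fin N => hZ x' ((j : ℤ) - i) + t * hZ x' ((j : ℤ) - i + 1) := by
        ext i j
        rw [Matrix.submatrix_apply, Matrix.updateCol_ne (Fin.succ_ne_zero j)]
        simp only [B, Matrix.of_apply, Fin.val_succ, g']
        push_cast
        simp only [add_sub_add_right_eq_sub]
      rw [h3, ih x' (by omega), Fin.prod_univ_castSucc]
      simp only [Fin.val_zero, if_true, x']
      ring
    · intro i
      rw [Matrix.updateCol_self]
      simp

/-- `∏ (1 + y_j S⁻¹) u` at `a`, where `S` is the shift of two-sided sequences. -/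
def backward {k : ℕ} (y : Fin k → ℂ) (u : ℤ → ℂ) (a : ℤ) : ℂ :=
  ∑ q ∈ Finset.range (k + 1), (ePoly y).coeff q * u (a + q)

theorem backward_succ {k : ℕ} (y : Fin (k + 1) → ℂ) (u : ℤ → ℂ) (a : ℤ) :
    backward y u a = backward (fun i => y i.castSucc) u a +
      y (Fin.last k) * backward (fun i => y i.castSucc) u (a + 1) := by
  have h1 : ∀ q, (ePoly y).coeff q = (ePoly fun i => y i.castSucc).coeff q +
      y (Fin.last k) * (Polynomial.X * ePoly fun i => y i.castSucc).coeff q := by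
    intro q
    rw [ePoly_succ, Polynomial.coeff_add, Polynomial.coeff_C_mul]
  have hz : (ePoly fun i => y i.castSucc).coeff (k + 1) = 0 :=
    Polynomial.coeff_eq_zero_of_natDegree_lt (lt_of_le_of_lt (natDegree_ePoly_le _) (Nat.lt_succ_self k))
  simp only [backward, h1, add_mul, Finset.sum_add_distrib]
  congr 1
  · rw [Finset.sum_range_succ, hz, zero_mul, add_zero]
  · rw [Finset.sum_range_succ', Finset.mul_sum]
    simp only [Polynomial.mul_coeff_zero, Polynomial.coeff_X_zero, zero_mul, mul_zero, add_zero,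
      Polynomial.coeff_X_mul]
    refine Finset.sum_congr rfl fun q _ => ?_
    rw [mul_assoc]
    congr 3
    push_cast
    ring

theorem recurrence_backward {n k : ℕ} (x : Fin n → ℂ) (y : Fin k → ℂ) (u : ℤ → ℂ) (a : ℤ) :
    recurrence x (backward y u) a = backward y (recurrence x u) a := by
  simp only [recurrence, backward, Finset.mul_sum]
  rw [Finset.sum_comm]
  refine Finset.sum_congr rfl fun q _ => Finset.sum_congr rfl fun i _ => ?_
  rw [show a - (i : ℤ) + q = a + q - i by ring]
  ring

/-- The factors 1 + y_j S⁻¹ are applied one at a time. Each preserves the recurrence, so the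
sequence remains a combination of shifts of h, and the determinant gains the factor computed in
`det_hZ_add_mul`. -/
theorem det_backward {n k : ℕ} (x : Fin n → ℂ) (y : Fin k → ℂ) (u : ℤ → ℂ)
    (hu : ∀ a, 1 ≤ a → recurrence x u a = 0) :
    Matrix.det (Matrix.of fun i t : Fin n => backward y u ((t : ℤ) - i)) =
      (∏ i, ∏ j, (1 + x i * y j)) * Matrix.det (Matrix.of fun i t : Fin n => u ((t : ℤ) - i)) := by
  induction k with
  | zero =>
    have : backward y u = u := by
      funext a
      simp [backward, ePoly]
    simp [this]
  | succ k ih =>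
    let v := backward (fun i => y i.castSucc) u
    have hv : ∀ a, 1 ≤ a → recurrence x v a = 0 := by
      intro a ha
      rw [recurrence_backward]
      exact Finset.sum_eq_zero fun q _ => by rw [hu _ (by omega), mul_zero]
    obtain ⟨Q, hQ⟩ := exists_matrix_eq_sum_hZ x v hv
    have h1 : (Matrix.of fun i t : Fin n => backward y u ((t : ℤ) - i)) =
        (Matrix.of fun i j : Fin n =>
          hZ x ((j : ℤ) - i) + y (Fin.last k) * hZ x ((j : ℤ) - i + 1)) * Q := by
      ext i t
      have hi := i.2
      have e1 := hQ (-(i : ℤ)) t (by omega)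
      have e2 := hQ (-(i : ℤ) + 1) t (by omega)
      rw [Matrix.mul_apply, Matrix.of_apply, backward_succ]
      change v _ + _ * v _ = _
      rw [show (t : ℤ) - i = -(i : ℤ) + t by ring, show -(i : ℤ) + t + 1 = -(i : ℤ) + 1 + t by ring,
        e1, e2, Finset.mul_sum, ← Finset.sum_add_distrib]
      refine Finset.sum_congr rfl fun j _ => ?_
      rw [Matrix.of_apply, show (j : ℤ) - i = -(i : ℤ) + j by ring,
        show -(i : ℤ) + j + 1 = -(i : ℤ) + 1 + j by ring]
      ring
    have h2 : (Matrix.of fun i t : Fin n => v ((t : ℤ) - i)) =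
        (Matrix.of fun i j : Fin n => hZ x ((j : ℤ) - i)) * Q := by
      ext i t
      have hi := i.2
      have e1 := hQ (-(i : ℤ)) t (by omega)
      simp only [neg_add_eq_sub] at e1
      rw [Matrix.mul_apply, Matrix.of_apply, e1]
      rfl
    have h3 := ih fun i => y i.castSucc
    change Matrix.det (Matrix.of fun i t : Fin n => v ((t : ℤ) - i)) = _ at h3
    rw [h2, Matrix.det_mul, det_hZ_sub, one_mul] at h3
    rw [h1, Matrix.det_mul, h3, det_hZ_add_mul x _ le_rfl, ← mul_assoc, ← Finset.prod_mul_distrib]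
    congr 1
    refine Finset.prod_congr rfl fun i _ => ?_
    rw [Fin.prod_univ_castSucc]
    ring

/-! ### Correlations of biorthogonal ensembles -/

-- The product is (1 + X)^p, where p counts the prescribed points that are occupied; since p ≤ r,
-- its X^r coefficient tests p = r.
open Classical in
theorem coeff_prod_one_add_X {n r : ℕ} (c : Fin n → ℤ) (hc : Function.Injective c)
    (s : Fin r → ℤ) (hs : Function.Injective s) :
    (∏ j, (1 + if c j ∈ Set.range s then (Polynomial.X : Polynomial ℂ) else 0)).coeff r =
      if ∀ i, s i ∈ Set.range c then 1 else 0 := by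
  have e : ∀ j, (1 + if c j ∈ Set.range s then (Polynomial.X : Polynomial ℂ) else 0) =
      if c j ∈ Set.range s then 1 + Polynomial.X else 1 := by
    intro j
    split_ifs <;> simp
  simp only [e]
  rw [Finset.prod_ite, Finset.prod_const, Finset.prod_const_one, mul_one,
    Polynomial.coeff_one_add_X_pow]
  set F := Finset.univ.filter fun j => c j ∈ Set.range s
  have hsub : F.image c ⊆ Finset.univ.image s := by
    intro a ha
    obtain ⟨j, hj, rfl⟩ := Finset.mem_image.1 ha
    obtain ⟨i, hi⟩ := (Finset.mem_filter.1 hj).2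
    exact Finset.mem_image.2 ⟨i, Finset.mem_univ _, hi⟩
  have hcF : (F.image c).card = F.card := Finset.card_image_of_injective _ hc
  have hcs : (Finset.univ.image s).card = r := by
    rw [Finset.card_image_of_injective _ hs, Finset.card_univ, Fintype.card_fin]
  split_ifs with h
  · have : Finset.univ.image s ⊆ F.image c := by
      intro a ha
      obtain ⟨i, _, rfl⟩ := Finset.mem_image.1 ha
      obtain ⟨j, hj⟩ := h i
      exact Finset.mem_image.2 ⟨j, Finset.mem_filter.2 ⟨Finset.mem_univ _, i, hj.symm⟩, hj⟩
    have hr : F.card = r := by rw [← hcF, ← hcs, hsub.antisymm this]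
    rw [hr, Nat.choose_self, Nat.cast_one]
  · have hlt : F.card < r := by
      rw [← hcF, ← hcs]
      refine Finset.card_lt_card (Finset.ssubset_iff_subset_ne.2 ⟨hsub, fun heq => h fun i => ?_⟩)
      have : s i ∈ F.image c := heq ▸ Finset.mem_image_of_mem s (Finset.mem_univ i)
      obtain ⟨j, _, hj⟩ := Finset.mem_image.1 this
      exact ⟨j, hj⟩
    rw [Nat.choose_eq_zero_of_lt hlt, Nat.cast_zero]

-- Give every prescribed point the weight 1 + X and apply Cauchy–Binet. Biorthonormality turns the
-- left side into det(1 + X A B) of size n, which equals det(1 + X B A) of size r. Its X^r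
-- coefficient is det(BA), the kernel minor, while on the diagram side that coefficient selects the
-- diagrams containing all the points.
open Classical in
theorem sum_det_mul_det_eq_det {n k r : ℕ} (f g : Fin n → ℤ → ℂ)
    (hfg : ∀ i j, ∑ a ∈ Finset.Icc (1 - (n : ℤ)) k, f i a * g j a = if i = j then 1 else 0)
    (s : Fin r → ℤ) (hs : Function.Injective s) (hW : ∀ i, s i ∈ Finset.Icc (1 - (n : ℤ)) k) :
    ∑ lam ∈ (boxDiagrams n k).filter
        fun lam => ∀ i, s i ∈ Set.range fun j : Fin n => coord lam j,
      Matrix.det (Matrix.of fun i j : Fin n => f i (coord lam j)) *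
        Matrix.det (Matrix.of fun i j : Fin n => g i (coord lam j)) =
      Matrix.det (Matrix.of fun i j : Fin r => ∑ l, f l (s i) * g l (s j)) := by
  let w : ℤ → Polynomial ℂ := fun a => 1 + if a ∈ Set.range s then Polynomial.X else 0
  have hCB := det_sum_mul_eq_sum_boxDiagrams (R := Polynomial ℂ) n k
    (fun i a => Polynomial.C (f i a)) (fun j a => w a * Polynomial.C (g j a))
  let A : Matrix (Fin n) (Fin r) ℂ := Matrix.of fun i p => f i (s p)
  let B : Matrix (Fin r) (Fin n) ℂ := Matrix.of fun p j => g j (s p)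
  have hL : (Matrix.of fun i j : Fin n => ∑ a ∈ Finset.Icc (1 - (n : ℤ)) k,
      Polynomial.C (f i a) * (w a * Polynomial.C (g j a))) =
      1 + (A.map Polynomial.C) * ((Polynomial.X : Polynomial ℂ) • B.map Polynomial.C) := by
    ext1 i j
    have h1 : ∀ a, Polynomial.C (f i a) * (w a * Polynomial.C (g j a)) =
        Polynomial.C (f i a * g j a) + if a ∈ Set.range s then
          Polynomial.X * Polynomial.C (f i a * g j a) else 0 := by
      intro a
      simp only [w]
      split_ifs
      · rw [Polynomial.C_mul]; ring
      · rw [Polynomial.C_mul]; ring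
    rw [Matrix.of_apply, Finset.sum_congr rfl fun a _ => h1 a, Finset.sum_add_distrib,
      ← map_sum, hfg, Matrix.add_apply, Matrix.one_apply, Matrix.mul_apply, ← Finset.sum_filter]
    congr 1
    · split_ifs <;> simp
    · have hI : (Finset.Icc (1 - (n : ℤ)) k).filter (fun a => a ∈ Set.range s) =
          Finset.univ.image s := by
        ext a
        simp only [Finset.mem_filter, Set.mem_range, Finset.mem_image, Finset.mem_univ, true_and]
        constructor
        · rintro ⟨_, h⟩; exact h
        · rintro ⟨i, rfl⟩; exact ⟨hW i, i, rfl⟩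
      rw [hI, Finset.sum_image fun _ _ _ _ h => hs h]
      refine Finset.sum_congr rfl fun p _ => ?_
      simp only [A, B, Matrix.map_apply, Matrix.of_apply, Matrix.smul_apply, smul_eq_mul,
        Polynomial.C_mul]
      ring
  have hR : ∀ lam : YoungDiagram,
      Matrix.det (Matrix.of fun i j : Fin n => Polynomial.C (f i (coord lam j))) *
        Matrix.det (Matrix.of fun i j : Fin n =>
          w (coord lam j) * Polynomial.C (g i (coord lam j))) =
      (∏ j : Fin n, w (coord lam j)) *
        Polynomial.C (Matrix.det (Matrix.of fun i j : Fin n => f i (coord lam j)) *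
        Matrix.det (Matrix.of fun i j : Fin n => g i (coord lam j))) := by
    intro lam
    have h1 := Matrix.det_mul_row (fun j : Fin n => w (coord lam j))
      (Matrix.of fun i j : Fin n => Polynomial.C (g i (coord lam j)))
    simp only [Matrix.of_apply] at h1
    rw [h1, Polynomial.C_mul, RingHom.map_det, RingHom.map_det]
    have e : ∀ h : Fin n → ℤ → ℂ, (Polynomial.C : ℂ →+* Polynomial ℂ).mapMatrix
        (Matrix.of fun i j : Fin n => h i (coord lam j)) =
        Matrix.of fun i j : Fin n => Polynomial.C (h i (coord lam j)) := fun h => rfl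
    rw [e, e]
    ring
  rw [hL, Matrix.det_one_add_mul_comm, Finset.sum_congr rfl fun lam _ => hR lam] at hCB
  have hC := congrArg (fun p => Polynomial.coeff p r) hCB
  simp only [Polynomial.finsetSum_coeff, Polynomial.coeff_mul_C] at hC
  have h2 : (1 : Matrix (Fin r) (Fin r) (Polynomial ℂ)) +
      ((Polynomial.X : Polynomial ℂ) • B.map Polynomial.C) * A.map Polynomial.C =
      (Polynomial.X : Polynomial ℂ) • (B * A).map Polynomial.C +
        (1 : Matrix (Fin r) (Fin r) ℂ).map Polynomial.C := by
    rw [Matrix.smul_mul, Matrix.map_mul, Matrix.map_one _ (map_zero _) (map_one _), add_comm]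
  rw [h2] at hC
  have h3 := Polynomial.coeff_det_X_add_C_card (B * A) (1 : Matrix (Fin r) (Fin r) ℂ)
  rw [Fintype.card_fin] at h3
  rw [h3] at hC
  have h4 : (B * A).det =
      Matrix.det (Matrix.of fun i j : Fin r => ∑ l, f l (s i) * g l (s j)) := by
    rw [← Matrix.det_transpose]
    congr 1
    ext i j
    rw [Matrix.transpose_apply, Matrix.mul_apply, Matrix.of_apply]
    exact Finset.sum_congr rfl fun l _ => mul_comm _ _
  rw [← h4, hC, Finset.sum_filter]
  refine Finset.sum_congr rfl fun lam _ => ?_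
  rw [coeff_prod_one_add_X (fun j : Fin n => coord lam j) (coord_strictAnti_fin lam n).injective
    s hs]
  simp only [ite_mul, one_mul, zero_mul]

/-! ### The kernel in terms of a two-sided sequence -/

/-- The correlation kernel built from a two-sided sequence `u`, in integer coordinates. -/
def kerZ {n k : ℕ} (x : Fin n → ℂ) (y : Fin k → ℂ) (u : ℤ → ℂ) (M M' : ℤ) : ℂ :=
  ∑ i ∈ Finset.range (n + 1), ∑ j ∈ Finset.range (k + 1),
    if M' + i ≤ j then signedE x i * (ePoly y).coeff j * u (M - M' - i + j) else 0

/-- For M' ≤ -n the cutoff M' + i ≤ j always holds, so the full operators in x and y act on u and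
leave the delta sequence. -/
theorem kerZ_of_le {n k : ℕ} (x : Fin n → ℂ) (y : Fin k → ℂ) (u : ℤ → ℂ)
    (hu : ∀ a, backward y u a = hZ x a) {M M' : ℤ} (h : M' ≤ -(n : ℤ)) :
    kerZ x y u M M' = if M = M' then 1 else 0 := by
  have h1 : kerZ x y u M M' = recurrence x (backward y u) (M - M') := by
    simp only [kerZ, recurrence, backward, Finset.mul_sum]
    refine Finset.sum_congr rfl fun i hi => Finset.sum_congr rfl fun j _ => ?_
    have := Finset.mem_range.1 hi
    rw [if_pos (by omega), mul_assoc]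
  rw [h1, funext hu, recurrence_hZ]
  simp only [sub_eq_zero]

theorem kerZ_of_gt {n k : ℕ} (x : Fin n → ℂ) (y : Fin k → ℂ) (u : ℤ → ℂ) {M M' : ℤ}
    (h : (k : ℤ) < M') : kerZ x y u M M' = 0 := by
  refine Finset.sum_eq_zero fun i _ => Finset.sum_eq_zero fun j hj => ?_
  have := Finset.mem_range.1 hj
  rw [if_neg (by omega)]

theorem sum_range_eq_sum_of_support {F : ℤ → ℂ} {A : ℤ} {L : ℕ} {S : Finset ℤ}
    (h1 : ∀ a, F a ≠ 0 → A ≤ a ∧ a < A + L) (h2 : ∀ a, F a ≠ 0 → a ∈ S) :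
    ∑ i ∈ Finset.range L, F (A + i) = ∑ a ∈ S, F a := by
  refine Finset.sum_bij_ne_zero (fun i _ _ => A + i) ?_ ?_ ?_ ?_
  · intro i _ hne
    exact h2 _ hne
  · intro i _ _ j _ _ h
    omega
  · intro a _ hne
    have := h1 a hne
    have e : A + ((a - A).toNat : ℤ) = a := by omega
    exact ⟨(a - A).toNat, Finset.mem_range.2 (by omega), by rwa [e], e⟩
  · intro i _ _
    rfl

theorem sum_range_eq_sum_range_of_support {F : ℤ → ℂ} {A B : ℤ} {L L' : ℕ}
    (h1 : ∀ a, F a ≠ 0 → A ≤ a ∧ a < A + L) (h2 : ∀ a, F a ≠ 0 → B ≤ a ∧ a < B + L') :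
    ∑ i ∈ Finset.range L, F (A + i) = ∑ i ∈ Finset.range L', F (B + i) := by
  rw [sum_range_eq_sum_of_support (S := Finset.Ico B (B + L')) h1
    (fun a h => Finset.mem_Ico.2 (h2 a h)), sum_range_eq_sum_of_support h2
    (fun a h => Finset.mem_Ico.2 (h2 a h))]

/-- The biorthogonal partner of the sequence `M ↦ e_{M + l}(y)`. -/
def partner {n : ℕ} (x : Fin n → ℂ) (u : ℤ → ℂ) (l : ℕ) (M : ℤ) : ℂ :=
  ∑ t ∈ Finset.range (l + 1), signedE x (l - t) * u (M + t)

theorem partner_eq {n : ℕ} (x : Fin n → ℂ) (u : ℤ → ℂ) (l : ℕ) (M : ℤ) :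
    partner x u l M = ∑ i ∈ Finset.range (n + 1),
      if i ≤ l then signedE x i * u (M + l - i) else 0 := by
  rw [partner, ← Finset.sum_flip]
  have h1 : ∑ r ∈ Finset.range (l + 1), signedE x (l - (l - r)) * u (M + ((l - r : ℕ) : ℤ)) =
      ∑ i ∈ Finset.range (l + 1), if i ≤ l then signedE x i * u (M + l - i) else 0 := by
    refine Finset.sum_congr rfl fun i hi => ?_
    have hi' : i ≤ l := Nat.lt_succ_iff.1 (Finset.mem_range.1 hi)
    rw [if_pos hi', Nat.sub_sub_self hi', Nat.cast_sub hi', add_sub_assoc]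
  rw [h1, Finset.sum_subset (s₂ := Finset.range (n + l + 1)),
    Finset.sum_subset (s₁ := Finset.range (n + 1)) (s₂ := Finset.range (n + l + 1))]
  · intro i hi
    simp only [Finset.mem_range] at hi ⊢
    omega
  · intro i _ hi
    simp only [Finset.mem_range] at hi
    rw [signedE_of_gt x (by omega), zero_mul, ite_self]
  · intro i hi
    simp only [Finset.mem_range] at hi ⊢
    omega
  · intro i _ hi
    simp only [Finset.mem_range] at hi
    rw [if_neg (by omega)]

theorem eZ_natCast {k : ℕ} (y : Fin k → ℂ) (j : ℕ) : eZ y j = (ePoly y).coeff j :=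
  extendZ_natCast _ _

theorem bounds_of_eZ_ne_zero {k : ℕ} (y : Fin k → ℂ) {a : ℤ} (h : eZ y a ≠ 0) :
    0 ≤ a ∧ a ≤ k := by
  constructor
  · by_contra! h'
    exact h (eZ_of_neg y h')
  · by_contra! h'
    exact h (eZ_of_gt y h')

/-- Substituting j = M' + l turns the cutoff into i ≤ l. For l ≥ n this is no restriction on i, so
the inner sum is the recurrence at M + l ≥ 1 and vanishes; only n terms remain. -/
theorem kerZ_eq_sum_partner {n k : ℕ} (x : Fin n → ℂ) (y : Fin k → ℂ) (u : ℤ → ℂ)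
    (hu : ∀ a, 1 ≤ a → recurrence x u a = 0) {M M' : ℤ} (hM : -(n : ℤ) < M)
    (hM' : -(n : ℤ) < M') :
    kerZ x y u M M' = ∑ l : Fin n, partner x u l M * eZ y (M' + l) := by
  have h1 : ∀ i : ℕ, ∑ j ∈ Finset.range (k + 1),
      (if M' + i ≤ j then signedE x i * (ePoly y).coeff j * u (M - M' - i + j) else 0) =
      ∑ l ∈ Finset.range (n + (k + 1)), (if i ≤ l then signedE x i * u (M + l - i) else 0) *
        eZ y (M' + l) := by
    intro i
    let F : ℤ → ℂ := fun a => if M' + i ≤ a then signedE x i * eZ y a * u (M - M' - i + a) else 0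
    have hF : ∀ a, F a ≠ 0 → M' + i ≤ a ∧ 0 ≤ a ∧ a ≤ k := by
      intro a ha
      simp only [F] at ha
      split_ifs at ha with hc
      · exact ⟨hc, bounds_of_eZ_ne_zero y (fun h => ha (by simp [h]))⟩
      · exact absurd rfl ha
    -- As M' > -n, the n + k + 1 values starting from M' reach k, the end of the support of e.
    have h := sum_range_eq_sum_range_of_support (F := F) (A := 0) (L := k + 1) (B := M')
      (L' := n + (k + 1)) (fun a ha => by have := hF a ha; push_cast; omega)
      (fun a ha => by have := hF a ha; push_cast; omega)
    refine Eq.trans ?_ (h.trans ?_)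
    · refine Finset.sum_congr rfl fun j _ => ?_
      simp only [F, zero_add, eZ_natCast]
    · refine Finset.sum_congr rfl fun l _ => ?_
      simp only [F, add_le_add_iff_left, Nat.cast_le]
      split_ifs
      · rw [show M - M' - (i : ℤ) + (M' + l) = M + l - i by ring]
        ring
      · rw [zero_mul]
  rw [kerZ, Finset.sum_congr rfl fun i _ => h1 i, Finset.sum_comm]
  simp only [← Finset.sum_mul, ← partner_eq]
  rw [Finset.sum_range_add, Finset.sum_range, Finset.sum_eq_zero (s := Finset.range (k + 1)),
    add_zero]
  intro s _
  have h2 : partner x u (n + s) M = recurrence x u (M + (n + s : ℕ)) := by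
    rw [partner_eq, recurrence]
    refine Finset.sum_congr rfl fun i hi => ?_
    have := Finset.mem_range.1 hi
    rw [if_pos (by omega)]
  rw [h2, hu _ (by push_cast; omega), zero_mul]

/-- Summing over a applies the y-operator to u and produces h; the remaining sum over i is then
`recurrence_hZ` at l - j. -/
theorem sum_partner_mul_eZ {n k : ℕ} (x : Fin n → ℂ) (y : Fin k → ℂ) (u : ℤ → ℂ)
    (hu : ∀ a, backward y u a = hZ x a) (l j : Fin n) :
    ∑ a ∈ Finset.Icc (1 - (n : ℤ)) k, partner x u l a * eZ y (a + j) =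
      if l = j then 1 else 0 := by
  have hj := j.2
  simp only [partner_eq, Finset.sum_mul]
  rw [Finset.sum_comm]
  have h1 : ∀ i : ℕ, ∑ a ∈ Finset.Icc (1 - (n : ℤ)) k,
      (if i ≤ (l : ℕ) then signedE x i * u (a + l - i) else 0) * eZ y (a + j) =
      signedE x i * hZ x ((l : ℤ) - j - i) := by
    intro i
    by_cases hi : i ≤ (l : ℕ)
    · simp only [hi, if_true]
      have h := sum_range_eq_sum_of_support (F := fun a => u (a + l - i) * eZ y (a + j))
        (A := -(j : ℤ)) (L := k + 1) (S := Finset.Icc (1 - (n : ℤ)) k)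
        (fun a ha => by
          have := bounds_of_eZ_ne_zero y (right_ne_zero_of_mul ha)
          push_cast
          omega)
        (fun a ha => by
          have := bounds_of_eZ_ne_zero y (right_ne_zero_of_mul ha)
          rw [Finset.mem_Icc]
          omega)
      simp only [mul_assoc]
      rw [← Finset.mul_sum, ← h, ← hu, backward]
      congr 1
      refine Finset.sum_congr rfl fun q _ => ?_
      rw [neg_add_cancel_comm, eZ_natCast, mul_comm]
      congr 2
      ring
    -- The truncation i ≤ l in `partner` is harmless: beyond it the index l - j - i is negative.
    · simp only [hi, if_false, zero_mul, Finset.sum_const_zero]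
      rw [hZ_of_neg x (by omega), mul_zero]
  rw [Finset.sum_congr rfl fun i _ => h1 i]
  refine (recurrence_hZ x ((l : ℤ) - j)).trans ?_
  have : (l : ℤ) - j = 0 ↔ l = j := by
    rw [Fin.ext_iff]
    omega
  simp only [this]

/-- The partners arise from the shifts of u by a lower unitriangular matrix, as the zeroth
coefficient of ∏(1 - x_i X) is 1. -/
theorem det_partner {n : ℕ} (x : Fin n → ℂ) (u : ℤ → ℂ) (a : Fin n → ℤ) :
    Matrix.det (Matrix.of fun i j : Fin n => partner x u i (a j)) =
      Matrix.det (Matrix.of fun i t : Fin n => u (a i + t)) := by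
  let E : Matrix (Fin n) (Fin n) ℂ :=
    Matrix.of fun l t => if t ≤ l then signedE x ((l : ℕ) - t) else 0
  have h1 : (Matrix.of fun i j : Fin n => partner x u i (a j)) =
      E * (Matrix.of fun i t : Fin n => u (a i + t)).transpose := by
    ext l j
    rw [Matrix.mul_apply, Matrix.of_apply, partner]
    simp only [E, Matrix.of_apply, Matrix.transpose_apply, ite_mul, zero_mul]
    rw [← Finset.sum_filter]
    refine Finset.sum_bij (fun t ht => ⟨t, (Finset.mem_range.1 ht).trans_le l.2⟩) ?_ ?_ ?_ ?_
    · intro t ht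
      exact Finset.mem_filter.2 ⟨Finset.mem_univ _,
        Fin.le_def.2 (Nat.lt_succ_iff.1 (Finset.mem_range.1 ht))⟩
    · intro t _ t' _ h
      exact congrArg Fin.val h
    · intro t ht
      have : (t : ℕ) ≤ l := (Finset.mem_filter.1 ht).2
      exact ⟨t, Finset.mem_range.2 (by omega), rfl⟩
    · intro t _
      rfl
  have h2 : E.det = 1 := by
    rw [Matrix.det_of_isLowerTriangular]
    · exact Finset.prod_eq_one fun i _ => by simp [E, signedE_zero]
    · intro i j hij
      have : i < j := hij
      simp only [E, Matrix.of_apply]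
      rw [if_neg (not_le.2 this)]
  rw [h1, Matrix.det_mul, h2, one_mul, Matrix.det_transpose]

/-! ### The weights and correlations as minors of the integer kernel -/

section

variable {n k : ℕ} (x : Fin n → ℝ) (y : Fin k → ℝ) (u : ℤ → ℂ)

theorem prod_one_add_ne_zero (hx : ∀ i, 0 ≤ x i) (hy : ∀ j, 0 ≤ y j) :
    (∏ i, ∏ j, (1 + (x i : ℂ) * (y j : ℂ))) ≠ 0 := by
  refine Finset.prod_ne_zero_iff.2 fun i _ => Finset.prod_ne_zero_iff.2 fun j _ => ?_
  have : (0 : ℝ) < 1 + x i * y j := by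
    have := mul_nonneg (hx i) (hy j)
    linarith
  exact_mod_cast this.ne'

/-- The dual Cauchy weight is a product of two determinants of biorthogonal functions. -/
theorem dualCauchyMeasure_eq_det_mul_det (hx : ∀ i, 0 ≤ x i) (hy : ∀ j, 0 ≤ y j)
    (h1 : ∀ a, 1 ≤ a → recurrence (fun i => (x i : ℂ)) u a = 0)
    (h2 : ∀ a, backward (fun j => (y j : ℂ)) u a = hZ (fun i => (x i : ℂ)) a)
    {lam : YoungDiagram} (hl : lam ∈ boxDiagrams n k) :
    (dualCauchyMeasure x y lam : ℂ) =
      Matrix.det (Matrix.of fun i j : Fin n => partner (fun i => (x i : ℂ)) u i (coord lam j)) *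
        Matrix.det (Matrix.of fun i j : Fin n => eZ (fun j => (y j : ℂ)) (coord lam j + i)) := by
  have hD := prod_one_add_ne_zero x y hx hy
  have h3 := det_backward (fun i => (x i : ℂ)) (fun j => (y j : ℂ)) u h1
  rw [funext h2, det_hZ_sub] at h3
  rw [det_partner, det_eq_det_hZ_mul _ u h1 _ fun i => by
    have := (Finset.mem_Icc.1 (coord_mem_Icc hl i)).1
    omega]
  have h4 := schur_transpose_eq_det_eZ y hl
  rw [← Matrix.det_transpose] at h4
  change _ = Matrix.det (Matrix.of fun i j : Fin n =>
    eZ (fun j => (y j : ℂ)) (coord lam j + i)) at h4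
  rw [← h4, ← schur_eq_det_hZ x hl, dualCauchyMeasure]
  push_cast
  rw [div_eq_iff hD]
  linear_combination (-(schur lam x : ℂ) * (schur lam.transpose y : ℂ)) * h3.symm

theorem dualCauchyMeasure_eq_det_kerZ (hx : ∀ i, 0 ≤ x i) (hy : ∀ j, 0 ≤ y j)
    (h1 : ∀ a, 1 ≤ a → recurrence (fun i => (x i : ℂ)) u a = 0)
    (h2 : ∀ a, backward (fun j => (y j : ℂ)) u a = hZ (fun i => (x i : ℂ)) a)
    {lam : YoungDiagram} (hl : lam ∈ boxDiagrams n k) :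
    (dualCauchyMeasure x y lam : ℂ) = Matrix.det (Matrix.of fun i j : Fin n =>
      kerZ (fun i => (x i : ℂ)) (fun j => (y j : ℂ)) u (coord lam i) (coord lam j)) := by
  rw [dualCauchyMeasure_eq_det_mul_det x y u hx hy h1 h2 hl, ← Matrix.det_transpose,
    ← Matrix.det_mul]
  congr 1
  ext i j
  have hw : ∀ i : Fin n, -(n : ℤ) < coord lam i := fun i => by
    have := (Finset.mem_Icc.1 (coord_mem_Icc hl i)).1
    omega
  rw [Matrix.of_apply, kerZ_eq_sum_partner _ _ u h1 (hw i) (hw j), Matrix.mul_apply]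
  rfl

theorem coord_eq_neg_of_le {lam : YoungDiagram} (hl : lam ∈ boxDiagrams n k) {i : ℕ}
    (hi : n ≤ i) : coord lam i = -i := by
  simp [coord, rowLen_eq_zero_of_mem_box hl hi]

-- Sites outside the window are removed first: one above k is never occupied and has a zero kernel
-- column; one at or below -n is always occupied and has a delta column. Induction on r serves only
-- to delete the latter.
open Classical in
theorem correlation_eq_det_kerZ (hx : ∀ i, 0 ≤ x i) (hy : ∀ j, 0 ≤ y j)
    (h1 : ∀ a, 1 ≤ a → recurrence (fun i => (x i : ℂ)) u a = 0)
    (h2 : ∀ a, backward (fun j => (y j : ℂ)) u a = hZ (fun i => (x i : ℂ)) a)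
    {r : ℕ} (s : Fin r → ℤ) (hs : Function.Injective s) :
    ∑ lam ∈ (boxDiagrams n k).filter (fun lam => ∀ i, s i ∈ Set.range (coord lam)),
      (dualCauchyMeasure x y lam : ℂ) = Matrix.det (Matrix.of fun i j : Fin r =>
        kerZ (fun i => (x i : ℂ)) (fun j => (y j : ℂ)) u (s i) (s j)) := by
  induction r with
  | zero =>
    have h := sum_det_mul_det_eq_det (k := k) (fun l : Fin n => partner (fun i => (x i : ℂ)) u l)
      (fun (l : Fin n) a => eZ (fun j => (y j : ℂ)) (a + l))
      (sum_partner_mul_eZ _ _ u h2) s hs (fun i => i.elim0)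
    rw [Matrix.det_fin_zero] at h ⊢
    rw [← h]
    refine Finset.sum_congr ?_ fun lam hl =>
      dualCauchyMeasure_eq_det_mul_det x y u hx hy h1 h2 (Finset.mem_filter.1 hl).1
    simp
  | succ r ih =>
    by_cases hgt : ∃ i, (k : ℤ) < s i
    · obtain ⟨i, hi⟩ := hgt
      rw [Matrix.det_eq_zero_of_column_eq_zero i fun j => kerZ_of_gt _ _ u hi]
      refine Finset.sum_eq_zero fun lam hl => absurd ((Finset.mem_filter.1 hl).2 i) ?_
      rintro ⟨j, hj⟩
      have := rowLen_le_of_mem_box (Finset.mem_filter.1 hl).1 j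
      simp only [coord] at hj
      omega
    by_cases hle : ∃ i, s i ≤ -(n : ℤ)
    · obtain ⟨i, hi⟩ := hle
      -- Column i is a unit vector, because the points are distinct; expanding along it deletes the
      -- point.
      rw [Matrix.det_succ_column _ i, Finset.sum_eq_single i]
      · have h3 := ih (fun j => s (i.succAbove j)) (hs.comp Fin.succAbove_right_injective)
        simp only [Matrix.of_apply]
        rw [kerZ_of_le _ _ u h2 hi, if_pos rfl, ← two_mul, pow_mul, neg_one_sq, one_pow, one_mul,
          one_mul]
        refine Eq.trans (Finset.sum_congr ?_ fun _ _ => rfl) h3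
        ext lam
        simp only [Finset.mem_filter, and_congr_right_iff]
        intro hl
        constructor
        · exact fun h j => h _
        · intro h j
          by_cases hj : j = i
          · subst hj
            refine ⟨(-(s j)).toNat, ?_⟩
            rw [coord_eq_neg_of_le hl (by omega)]
            omega
          · obtain ⟨j', rfl⟩ := Fin.exists_succAbove_eq hj
            exact h j'
      · intro j _ hj
        simp only [Matrix.of_apply]
        rw [kerZ_of_le _ _ u h2 hi, if_neg (fun h => hj (hs h))]
        ring
      · simp
    · push Not at hgt hle
      have hW : ∀ i, s i ∈ Finset.Icc (1 - (n : ℤ)) k := fun i => by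
        have := hgt i
        have := hle i
        rw [Finset.mem_Icc]
        omega
      have h := sum_det_mul_det_eq_det (k := k) (fun l : Fin n => partner (fun i => (x i : ℂ)) u l)
        (fun (l : Fin n) a => eZ (fun j => (y j : ℂ)) (a + l))
        (sum_partner_mul_eZ _ _ u h2) s hs hW
      have e : (Matrix.of fun i j : Fin (r + 1) =>
          kerZ (fun i => (x i : ℂ)) (fun j => (y j : ℂ)) u (s i) (s j)) =
          Matrix.of fun i j : Fin (r + 1) => ∑ l : Fin n,
            partner (fun i => (x i : ℂ)) u l (s i) * eZ (fun j => (y j : ℂ)) (s j + l) := by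
        ext i j
        exact kerZ_eq_sum_partner _ _ u h1 (hle i) (hle j)
      rw [e, ← h]
      refine Finset.sum_congr ?_ fun lam hl =>
        dualCauchyMeasure_eq_det_mul_det x y u hx hy h1 h2 (Finset.mem_filter.1 hl).1
      ext lam
      simp only [Finset.mem_filter, and_congr_right_iff]
      intro hl
      refine forall_congr' fun i => ?_
      constructor
      · rintro ⟨j, hj⟩
        by_cases hjn : j < n
        · exact ⟨⟨j, hjn⟩, hj⟩
        · rw [coord_eq_neg_of_le hl (not_lt.1 hjn)] at hj
          have := hle i
          omega
      · rintro ⟨j, hj⟩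
        exact ⟨j, hj⟩

end

/-! ### Integration along piecewise continuously differentiable closed curves -/

theorem intervalIntegrable_comp_mul_deriv {γ : ℝ → ℂ} {a b : ℝ} (hab : a ≤ b)
    (hγ : ContDiffOn ℝ 1 γ (Set.Icc a b)) {f : ℂ → ℂ}
    (hf : ContinuousOn (fun t => f (γ t)) (Set.Icc a b)) :
    IntervalIntegrable (fun t => f (γ t) * deriv γ t) MeasureTheory.volume a b := by
  -- Partitions are only monotone, so a piece may be degenerate. On a genuine piece `deriv` agrees
  -- with the continuous `derivWithin` in the interior.
  rcases hab.eq_or_lt with rfl | hlt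
  · exact IntervalIntegrable.refl
  have h1 : ContinuousOn (fun t => f (γ t) * derivWithin γ (Set.Icc a b) t) (Set.Icc a b) :=
    hf.mul (hγ.continuousOn_derivWithin (uniqueDiffOn_Icc hlt) le_rfl)
  refine (ContinuousOn.intervalIntegrable_of_Icc hab h1).congr_uIoo fun t ht => ?_
  rw [Set.uIoo_of_le hab] at ht
  simp only
  rw [derivWithin_of_mem_nhds (Icc_mem_nhds ht.1 ht.2)]

theorem integral_comp_mul_deriv_eq_sub {γ : ℝ → ℂ} {a b : ℝ} (hab : a ≤ b)
    (hγ : ContDiffOn ℝ 1 γ (Set.Icc a b)) {f F : ℂ → ℂ}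
    (hf : ContinuousOn (fun t => f (γ t)) (Set.Icc a b))
    (hF : ∀ t ∈ Set.Icc a b, HasDerivAt F (f (γ t)) (γ t)) :
    ∫ t in a..b, f (γ t) * deriv γ t = F (γ b) - F (γ a) := by
  refine intervalIntegral.integral_eq_sub_of_hasDerivAt_of_le (f := fun t => F (γ t)) hab ?_ ?_
    (intervalIntegrable_comp_mul_deriv hab hγ hf)
  · intro t ht
    exact (hF t ht).continuousAt.comp_continuousWithinAt (hγ.continuousOn t ht)
  · intro t ht
    have hd : DifferentiableAt ℝ γ t :=
      (hγ.differentiableOn one_ne_zero).differentiableAt (Icc_mem_nhds ht.1 ht.2)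
    exact (hF t (Set.Ioo_subset_Icc_self ht)).comp_of_eq t hd.hasDerivAt rfl

theorem Icc_piece_subset {N : ℕ} {t : ℕ → ℝ} (ht : Monotone t) (h0 : t 0 = 0) (h1 : t N = 1)
    {i : ℕ} (hi : i < N) : Set.Icc (t i) (t (i + 1)) ⊆ Set.Icc 0 1 :=
  Set.Icc_subset_Icc (h0 ▸ ht (Nat.zero_le i)) (h1 ▸ ht hi)

theorem IsContour.continuousOn_piece {γ : ℝ → ℂ} {f : ℂ → ℂ} (hf : ContinuousOn f (trace γ))
    {a b : ℝ} (hγ : ContDiffOn ℝ 1 γ (Set.Icc a b)) (hsub : Set.Icc a b ⊆ Set.Icc 0 1) :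
    ContinuousOn (fun t => f (γ t)) (Set.Icc a b) :=
  hf.comp hγ.continuousOn fun _ ht => Set.mem_image_of_mem γ (hsub ht)

theorem IsContour.intervalIntegrable {γ : ℝ → ℂ} (hγ : IsContour γ) {f : ℂ → ℂ}
    (hf : ContinuousOn f (trace γ)) :
    IntervalIntegrable (fun t => f (γ t) * deriv γ t) MeasureTheory.volume 0 1 := by
  obtain ⟨_, N, t, ht, h0, h1, hC⟩ := hγ
  have h : ∀ i < N, IntervalIntegrable (fun t => f (γ t) * deriv γ t) MeasureTheory.volume
      (t i) (t (i + 1)) := fun i hi =>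
    intervalIntegrable_comp_mul_deriv (ht (Nat.le_succ i)) (hC i hi)
      (continuousOn_piece hf (hC i hi) (Icc_piece_subset ht h0 h1 hi))
  rw [← h0, ← h1]
  exact IntervalIntegrable.trans_iterate h

/-- The integral of a function with a primitive along a closed curve vanishes. -/
theorem IsContour.integral_eq_zero {γ : ℝ → ℂ} (hγ : IsContour γ) {f F : ℂ → ℂ}
    (hf : ContinuousOn f (trace γ)) (hF : ∀ z ∈ trace γ, HasDerivAt F (f z) z) :
    contourIntegral γ f = 0 := by
  obtain ⟨hcl, N, t, ht, h0, h1, hC⟩ := hγ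
  have hsub := fun {i : ℕ} (hi : i < N) => Icc_piece_subset ht h0 h1 hi
  have h : ∀ i < N, IntervalIntegrable (fun t => f (γ t) * deriv γ t) MeasureTheory.volume
      (t i) (t (i + 1)) := fun i hi =>
    intervalIntegrable_comp_mul_deriv (ht (Nat.le_succ i)) (hC i hi)
      (continuousOn_piece hf (hC i hi) (hsub hi))
  have hs := intervalIntegral.sum_integral_adjacent_intervals h
  rw [h0, h1] at hs
  rw [contourIntegral, ← hs]
  have h2 : ∀ i ∈ Finset.range N, ∫ s in t i..t (i + 1), f (γ s) * deriv γ s =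
      F (γ (t (i + 1))) - F (γ (t i)) := fun i hi =>
    integral_comp_mul_deriv_eq_sub (ht (Nat.le_succ i)) (hC i (Finset.mem_range.1 hi))
      (continuousOn_piece hf (hC i (Finset.mem_range.1 hi)) (hsub (Finset.mem_range.1 hi)))
      fun s hs => hF _ (Set.mem_image_of_mem γ (hsub (Finset.mem_range.1 hi) hs))
  rw [Finset.sum_congr rfl h2, Finset.sum_range_sub (fun i => F (γ (t i))), h0, h1, hcl, sub_self]

theorem contourIntegral_congr {γ : ℝ → ℂ} {f g : ℂ → ℂ} (h : ∀ z ∈ trace γ, f z = g z) :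
    contourIntegral γ f = contourIntegral γ g := by
  refine intervalIntegral.integral_congr fun t ht => ?_
  rw [Set.uIcc_of_le zero_le_one] at ht
  rw [h _ (Set.mem_image_of_mem γ ht)]

theorem contourIntegral_const_mul (γ : ℝ → ℂ) (c : ℂ) (f : ℂ → ℂ) :
    contourIntegral γ (fun z => c * f z) = c * contourIntegral γ f := by
  simp only [contourIntegral, mul_assoc]
  exact intervalIntegral.integral_const_mul _ _

theorem IsContour.integral_add {γ : ℝ → ℂ} (hγ : IsContour γ) {f g : ℂ → ℂ}
    (hf : ContinuousOn f (trace γ)) (hg : ContinuousOn g (trace γ)) :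
    contourIntegral γ (fun z => f z + g z) = contourIntegral γ f + contourIntegral γ g := by
  simp only [contourIntegral, add_mul]
  exact intervalIntegral.integral_add (hγ.intervalIntegrable hf) (hγ.intervalIntegrable hg)

theorem IsContour.integral_sub {γ : ℝ → ℂ} (hγ : IsContour γ) {f g : ℂ → ℂ}
    (hf : ContinuousOn f (trace γ)) (hg : ContinuousOn g (trace γ)) :
    contourIntegral γ (fun z => f z - g z) = contourIntegral γ f - contourIntegral γ g := by
  simp only [contourIntegral, sub_mul]
  exact intervalIntegral.integral_sub (hγ.intervalIntegrable hf) (hγ.intervalIntegrable hg)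

theorem IsContour.integral_sum {ι : Type*} {γ : ℝ → ℂ} (hγ : IsContour γ) (s : Finset ι)
    {f : ι → ℂ → ℂ} (hf : ∀ i ∈ s, ContinuousOn (f i) (trace γ)) :
    contourIntegral γ (fun z => ∑ i ∈ s, f i z) = ∑ i ∈ s, contourIntegral γ (f i) := by
  simp only [contourIntegral, Finset.sum_mul]
  exact intervalIntegral.integral_finsetSum fun i hi => hγ.intervalIntegrable (hf i hi)

/-! ### Integrals of rational functions -/

theorem IsContour.integral_zpow {γ : ℝ → ℂ} (hγ : IsContour γ) {p : ℂ} {e : ℤ}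
    (hp : p ∉ trace γ ∨ 0 ≤ e) (he : e ≠ -1) : contourIntegral γ (fun z => (z - p) ^ e) = 0 := by
  have hne : ∀ z ∈ trace γ, z - p ≠ 0 ∨ 0 ≤ e := fun z hz =>
    hp.imp (fun h h0 => h (sub_eq_zero.1 h0 ▸ hz)) id
  have he' : ((e + 1 : ℤ) : ℂ) ≠ 0 := by
    exact_mod_cast fun h : e + 1 = 0 => he (by omega)
  refine hγ.integral_eq_zero (F := fun z => (z - p) ^ (e + 1) / ((e + 1 : ℤ) : ℂ)) ?_ ?_
  · exact ContinuousOn.zpow₀ (continuousOn_id.sub continuousOn_const) e hne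
  · intro z hz
    have h1 := (hasDerivAt_zpow (e + 1) (z - p) ((hne z hz).imp_right fun h => by omega)).comp z
      ((hasDerivAt_id z).sub_const p)
    have h2 := h1.div_const ((e + 1 : ℤ) : ℂ)
    have e1 : ((e + 1 : ℤ) : ℂ) * (z - p) ^ (e + 1 - 1) * 1 / ((e + 1 : ℤ) : ℂ) = (z - p) ^ e := by
      rw [add_sub_cancel_right, mul_one, mul_div_cancel_left₀ _ he']
    rw [e1] at h2
    exact h2

/-- The function `∏ 1 / (z - p)` over a multiset of poles. -/
def poleProd (P : Multiset ℂ) (z : ℂ) : ℂ := (P.map fun p => (z - p)⁻¹).prod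

theorem poleProd_zero (z : ℂ) : poleProd 0 z = 1 := by simp [poleProd]

theorem poleProd_cons (p : ℂ) (P : Multiset ℂ) (z : ℂ) :
    poleProd (p ::ₘ P) z = (z - p)⁻¹ * poleProd P z := by simp [poleProd]

theorem poleProd_add (P Q : Multiset ℂ) (z : ℂ) :
    poleProd (P + Q) z = poleProd P z * poleProd Q z := by simp [poleProd]

theorem poleProd_replicate (m : ℕ) (p z : ℂ) :
    poleProd (Multiset.replicate m p) z = (z - p) ^ (-(m : ℤ)) := by
  simp [poleProd]

theorem continuousOn_poleProd {S : Set ℂ} {P : Multiset ℂ} (hP : ∀ p ∈ P, p ∉ S) :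
    ContinuousOn (poleProd P) S := by
  induction P using Multiset.induction_on with
  | empty =>
    rw [show poleProd 0 = fun _ => 1 from funext poleProd_zero]
    exact continuousOn_const
  | cons p P ih =>
    rw [show poleProd (p ::ₘ P) = fun z => (z - p)⁻¹ * poleProd P z from
      funext (poleProd_cons p P)]
    refine ContinuousOn.mul ?_ (ih fun q hq => hP q (Multiset.mem_cons_of_mem hq))
    refine ContinuousOn.inv₀ (continuousOn_id.sub continuousOn_const) fun z hz h => ?_
    exact hP p (Multiset.mem_cons_self p P) (sub_eq_zero.1 h ▸ hz)

/-- A functional on multisets of poles obeying the rule for partial fractions is determined by its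
values on simple poles. -/
theorem partialFractions_eq_zero {S : Set ℂ} {Φ : Multiset ℂ → ℂ}
    (hcons : ∀ p ∈ S, ∀ q ∈ S, p ≠ q → ∀ P : Multiset ℂ, (∀ a ∈ P, a ∈ S) →
      (p - q) * Φ (p ::ₘ q ::ₘ P) = Φ (p ::ₘ P) - Φ (q ::ₘ P))
    (hzero : Φ 0 = 0) (hrep : ∀ p ∈ S, ∀ m, 2 ≤ m → Φ (Multiset.replicate m p) = 0)
    (hone : ∀ p ∈ S, Φ {p} = 0) {P : Multiset ℂ} (hP : ∀ a ∈ P, a ∈ S) : Φ P = 0 := by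
  induction hn : P.card using Nat.strong_induction_on generalizing P with
  | _ n ih =>
    rcases Multiset.empty_or_exists_mem P with rfl | ⟨p, hp⟩
    · exact hzero
    obtain ⟨P', rfl⟩ := Multiset.exists_cons_of_mem hp
    have hpS := hP p (Multiset.mem_cons_self _ _)
    by_cases hq : ∃ q ∈ P', q ≠ p
    · obtain ⟨q, hq, hne⟩ := hq
      obtain ⟨P'', rfl⟩ := Multiset.exists_cons_of_mem hq
      have hqS := hP q (by simp)
      have hS : ∀ a ∈ P'', a ∈ S := fun a ha => hP a (by simp [ha])
      have h := hcons p hpS q hqS hne.symm P'' hS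
      simp only [Multiset.card_cons] at hn
      rw [ih (P''.card + 1) (by omega) (P := p ::ₘ P'')
          (fun a ha => (Multiset.mem_cons.1 ha).elim (fun e => e ▸ hpS) (hS a)) (by simp),
        ih (P''.card + 1) (by omega) (P := q ::ₘ P'')
          (fun a ha => (Multiset.mem_cons.1 ha).elim (fun e => e ▸ hqS) (hS a)) (by simp), sub_zero] at h
      exact (mul_eq_zero.1 h).resolve_left (sub_ne_zero.2 hne.symm)
    · push Not at hq
      have hr : p ::ₘ P' = Multiset.replicate (P'.card + 1) p := by
        rw [Multiset.replicate_succ, ← Multiset.eq_replicate_card.2 hq]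
      rw [hr]
      rcases Nat.eq_zero_or_pos P'.card with h0 | h0
      · rw [h0]
        exact hone p hpS
      · exact hrep p hpS _ (by omega)

/-- The integrated form of (p - q)/((z - p)(z - q)) = 1/(z - p) - 1/(z - q). It stands in for the
residue theorem: repeated poles have primitives, and simple poles give winding numbers. -/
theorem IsContour.poleProd_cons_cons {γ : ℝ → ℂ} (hγ : IsContour γ) {p q : ℂ} (hp : p ∉ trace γ)
    (hq : q ∉ trace γ) {P : Multiset ℂ} (hP : ∀ a ∈ P, a ∉ trace γ) :
    (p - q) * contourIntegral γ (poleProd (p ::ₘ q ::ₘ P)) =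
      contourIntegral γ (poleProd (p ::ₘ P)) - contourIntegral γ (poleProd (q ::ₘ P)) := by
  have hc : ∀ r ∉ trace γ, ContinuousOn (poleProd (r ::ₘ P)) (trace γ) := fun r hr =>
    continuousOn_poleProd fun a ha => (Multiset.mem_cons.1 ha).elim (fun e => e ▸ hr) (hP a)
  rw [← contourIntegral_const_mul, ← hγ.integral_sub (hc p hp) (hc q hq)]
  refine contourIntegral_congr fun z hz => ?_
  have h1 : z - p ≠ 0 := fun h => hp (sub_eq_zero.1 h ▸ hz)
  have h2 : z - q ≠ 0 := fun h => hq (sub_eq_zero.1 h ▸ hz)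
  simp only [poleProd_cons]
  field_simp
  ring

theorem IsContour.poleProd_replicate {γ : ℝ → ℂ} (hγ : IsContour γ) {p : ℂ} (hp : p ∉ trace γ)
    {m : ℕ} (hm : m ≠ 1) : contourIntegral γ (poleProd (Multiset.replicate m p)) = 0 := by
  rw [show poleProd (Multiset.replicate m p) = fun z => (z - p) ^ (-(m : ℤ)) from
    funext (DualCauchy.poleProd_replicate m p)]
  exact hγ.integral_zpow (Or.inl hp) (by omega)

theorem IsContour.poleProd_empty {γ : ℝ → ℂ} (hγ : IsContour γ) :
    contourIntegral γ (poleProd 0) = 0 := by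
  have h := hγ.integral_zpow (p := 0) (e := 0) (Or.inr le_rfl) (by omega)
  rw [← h]
  exact contourIntegral_congr fun z _ => by simp [poleProd_zero]

theorem two_pi_I_ne_zero : (2 * Real.pi * Complex.I : ℂ) ≠ 0 := Complex.two_pi_I_ne_zero

theorem contourIntegral_poleProd_singleton (γ : ℝ → ℂ) (p : ℂ) :
    contourIntegral γ (poleProd {p}) = 2 * Real.pi * Complex.I * windingNumber γ p := by
  rw [windingNumber, mul_inv_cancel_left₀ two_pi_I_ne_zero]
  exact contourIntegral_congr fun z _ => by simp [poleProd]

theorem IsContour.integral_poleProd_eq {γ γ' : ℝ → ℂ} (hγ : IsContour γ) (hγ' : IsContour γ')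
    {P : Multiset ℂ} (hP : ∀ p ∈ P, p ∉ trace γ ∧ p ∉ trace γ' ∧
      windingNumber γ p = windingNumber γ' p) :
    contourIntegral γ (poleProd P) = contourIntegral γ' (poleProd P) := by
  rw [← sub_eq_zero]
  refine partialFractions_eq_zero (S := {p | p ∉ trace γ ∧ p ∉ trace γ' ∧
      windingNumber γ p = windingNumber γ' p})
    (Φ := fun P => contourIntegral γ (poleProd P) - contourIntegral γ' (poleProd P))
    ?_ ?_ ?_ ?_ hP
  · intro p hp q hq _ P hP
    have h1 := hγ.poleProd_cons_cons hp.1 hq.1 (P := P) fun a ha => (hP a ha).1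
    have h2 := hγ'.poleProd_cons_cons hp.2.1 hq.2.1 (P := P) fun a ha => (hP a ha).2.1
    linear_combination h1 - h2
  · simp only [hγ.poleProd_empty, hγ'.poleProd_empty, sub_self]
  · intro p hp m hm
    simp only [hγ.poleProd_replicate hp.1 (show m ≠ 1 by omega),
      hγ'.poleProd_replicate hp.2.1 (show m ≠ 1 by omega), sub_self]
  · intro p hp
    simp only [contourIntegral_poleProd_singleton, hp.2.2, sub_self]

/-- With a common winding number c the integral is c times the total residue, which vanishes unless
there is exactly one pole. The values c = 0 and c = 1 are used for excluded and encircled poles. -/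
theorem IsContour.integral_poleProd_of_const {γ : ℝ → ℂ} (hγ : IsContour γ) {c : ℂ}
    {P : Multiset ℂ} (hP : ∀ p ∈ P, p ∉ trace γ ∧ windingNumber γ p = c) :
    contourIntegral γ (poleProd P) = if P.card = 1 then 2 * Real.pi * Complex.I * c else 0 := by
  rw [← sub_eq_zero]
  refine partialFractions_eq_zero (S := {p | p ∉ trace γ ∧ windingNumber γ p = c})
    (Φ := fun P => contourIntegral γ (poleProd P) -
      if P.card = 1 then 2 * Real.pi * Complex.I * c else 0) ?_ ?_ ?_ ?_ hP
  · intro p hp q hq _ P hP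
    have h1 := hγ.poleProd_cons_cons hp.1 hq.1 (P := P) fun a ha => (hP a ha).1
    simp only [Multiset.card_cons]
    rw [if_neg (by omega : ¬ (P.card + 1 + 1 = 1))]
    linear_combination h1
  · simp [hγ.poleProd_empty]
  · intro p hp m hm
    simp only [hγ.poleProd_replicate hp.1 (show m ≠ 1 by omega), Multiset.card_replicate]
    rw [if_neg (by omega), sub_zero]
  · intro p hp
    simp only [contourIntegral_poleProd_singleton, hp.2, Multiset.card_singleton, if_true, sub_self]

/-- Writing z = (z - p) + p lowers the power of z, so numerators reduce to pure pole products. -/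
theorem IsContour.pow_succ_mul_poleProd {γ : ℝ → ℂ} (hγ : IsContour γ) {p : ℂ} {P : Multiset ℂ}
    (hP : ∀ a ∈ p ::ₘ P, a ∉ trace γ) (j : ℕ) :
    contourIntegral γ (fun z => z ^ (j + 1) * poleProd (p ::ₘ P) z) =
      contourIntegral γ (fun z => z ^ j * poleProd P z) +
        p * contourIntegral γ (fun z => z ^ j * poleProd (p ::ₘ P) z) := by
  have hc : ContinuousOn (fun z => z ^ j * poleProd (p ::ₘ P) z) (trace γ) :=
    (continuousOn_pow j).mul (continuousOn_poleProd hP)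
  have hc' : ContinuousOn (fun z => p * (z ^ j * poleProd (p ::ₘ P) z)) (trace γ) :=
    continuousOn_const.mul hc
  rw [← contourIntegral_const_mul, ← hγ.integral_add _ hc']
  · refine contourIntegral_congr fun z hz => ?_
    have h1 : z - p ≠ 0 := fun h => hP p (Multiset.mem_cons_self p P) (sub_eq_zero.1 h ▸ hz)
    simp only [poleProd_cons]
    field_simp
    ring
  · exact (continuousOn_pow j).mul
      (continuousOn_poleProd fun a ha => hP a (Multiset.mem_cons_of_mem ha))

theorem IsContour.pow_mul_poleProd_empty {γ : ℝ → ℂ} (hγ : IsContour γ) (j : ℕ) :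
    contourIntegral γ (fun z => z ^ j * poleProd 0 z) = 0 := by
  have h := hγ.integral_zpow (p := 0) (e := j) (Or.inr (by omega)) (by omega)
  rw [← h]
  exact contourIntegral_congr fun z _ => by simp [poleProd_zero]

theorem IsContour.integral_pow_mul_poleProd_eq {γ γ' : ℝ → ℂ} (hγ : IsContour γ)
    (hγ' : IsContour γ') (j : ℕ) {P : Multiset ℂ} (hP : ∀ p ∈ P, p ∉ trace γ ∧ p ∉ trace γ' ∧
      windingNumber γ p = windingNumber γ' p) :
    contourIntegral γ (fun z => z ^ j * poleProd P z) =
      contourIntegral γ' (fun z => z ^ j * poleProd P z) := by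
  induction j generalizing P with
  | zero => simpa using hγ.integral_poleProd_eq hγ' hP
  | succ j ih =>
    induction P using Multiset.induction_on with
    | empty => rw [hγ.pow_mul_poleProd_empty, hγ'.pow_mul_poleProd_empty]
    | cons p P _ =>
      rw [hγ.pow_succ_mul_poleProd (fun a ha => (hP a ha).1),
        hγ'.pow_succ_mul_poleProd (fun a ha => (hP a ha).2.1), ih hP,
        ih fun a ha => hP a (Multiset.mem_cons_of_mem ha)]

theorem IsContour.integral_pow_mul_poleProd_of_excluded {γ : ℝ → ℂ} (hγ : IsContour γ) (j : ℕ)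
    {P : Multiset ℂ} (hP : ∀ p ∈ P, p ∉ trace γ ∧ windingNumber γ p = 0) :
    contourIntegral γ (fun z => z ^ j * poleProd P z) = 0 := by
  induction j generalizing P with
  | zero => simpa using hγ.integral_poleProd_of_const hP
  | succ j ih =>
    induction P using Multiset.induction_on with
    | empty => rw [hγ.pow_mul_poleProd_empty]
    | cons p P _ =>
      rw [hγ.pow_succ_mul_poleProd (fun a ha => (hP a ha).1), ih hP,
        ih fun a ha => hP a (Multiset.mem_cons_of_mem ha)]
      simp

theorem IsContour.integral_pow_mul_poleProd_of_const {γ : ℝ → ℂ} (hγ : IsContour γ) {c : ℂ}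
    (j : ℕ) {P : Multiset ℂ} (hP : ∀ p ∈ P, p ∉ trace γ ∧ windingNumber γ p = c)
    (hj : j + 2 ≤ P.card) :
    contourIntegral γ (fun z => z ^ j * poleProd P z) = 0 := by
  induction j generalizing P with
  | zero =>
    have h := hγ.integral_poleProd_of_const hP
    rw [if_neg (by omega)] at h
    simpa using h
  | succ j ih =>
    induction P using Multiset.induction_on with
    | empty => rw [hγ.pow_mul_poleProd_empty]
    | cons p P _ =>
      rw [Multiset.card_cons] at hj
      rw [hγ.pow_succ_mul_poleProd (fun a ha => (hP a ha).1),
        ih hP (by rw [Multiset.card_cons]; omega),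
        ih (fun a ha => hP a (Multiset.mem_cons_of_mem ha)) (by omega)]
      simp

theorem zpow_mul_poleProd (e : ℤ) (P : Multiset ℂ) {z : ℂ} (hz : z ≠ 0) :
    z ^ e * poleProd P z =
      z ^ e.toNat * poleProd (Multiset.replicate (-e).toNat 0 + P) z := by
  rw [poleProd_add, DualCauchy.poleProd_replicate, sub_zero, ← mul_assoc, ← zpow_natCast,
    ← zpow_add₀ hz]
  congr 2
  omega

theorem IsContour.integral_zpow_mul_poleProd_eq {γ γ' : ℝ → ℂ} (hγ : IsContour γ)
    (hγ' : IsContour γ') (h0 : Encircles γ 0) (h0' : Encircles γ' 0) (e : ℤ) {P : Multiset ℂ}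
    (hP : ∀ p ∈ P, p ∉ trace γ ∧ p ∉ trace γ' ∧ windingNumber γ p = windingNumber γ' p) :
    contourIntegral γ (fun z => z ^ e * poleProd P z) =
      contourIntegral γ' (fun z => z ^ e * poleProd P z) := by
  rw [contourIntegral_congr fun z hz => zpow_mul_poleProd e P fun h => h0.1 (h ▸ hz),
    contourIntegral_congr fun z hz => zpow_mul_poleProd e P fun h => h0'.1 (h ▸ hz)]
  refine hγ.integral_pow_mul_poleProd_eq hγ' _ fun p hp => ?_
  rcases Multiset.mem_add.1 hp with h | h
  · rw [Multiset.eq_of_mem_replicate h]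
    exact ⟨h0.1, h0'.1, h0.2.trans h0'.2.symm⟩
  · exact hP p h

/-- The integrand decays at least like z⁻² at infinity and all its poles are inside; negative powers
of z count as poles at 0. -/
theorem IsContour.integral_zpow_mul_poleProd_of_encircled {γ : ℝ → ℂ} (hγ : IsContour γ)
    (h0 : Encircles γ 0) (e : ℤ) {P : Multiset ℂ} (hP : ∀ p ∈ P, Encircles γ p)
    (he : e + 2 ≤ P.card) : contourIntegral γ (fun z => z ^ e * poleProd P z) = 0 := by
  rw [contourIntegral_congr fun z hz => zpow_mul_poleProd e P fun h => h0.1 (h ▸ hz)]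
  refine hγ.integral_pow_mul_poleProd_of_const (c := 1) _ (fun p hp => ?_) ?_
  · rcases Multiset.mem_add.1 hp with h | h
    · rw [Multiset.eq_of_mem_replicate h]
      exact h0
    · exact hP p h
  · rw [Multiset.card_add, Multiset.card_replicate]
    omega

/-! ### The two factors of the symbol -/

/-- The factor `∏ 1 / (1 - x_i z)` of the symbol. -/
def symbolA {n : ℕ} (x : Fin n → ℂ) (z : ℂ) : ℂ := ∏ i, 1 / (1 - x i * z)

/-- The factor `∏ 1 / (1 + y_j / z)` of the symbol. -/
def symbolB {k : ℕ} (y : Fin k → ℂ) (z : ℂ) : ℂ := ∏ j, 1 / (1 + y j / z)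

/-- The poles of `symbolA`. -/
def polesA {n : ℕ} (x : Fin n → ℂ) : Multiset ℂ :=
  (Finset.univ.filter fun i => x i ≠ 0).val.map fun i => (x i)⁻¹

/-- The nonzero poles of `symbolB`, and `0` for every vanishing parameter. -/
def polesB {k : ℕ} (y : Fin k → ℂ) : Multiset ℂ := (Finset.univ : Finset (Fin k)).val.map fun j => -y j

theorem exists_of_mem_polesA {n : ℕ} {x : Fin n → ℂ} {p : ℂ} (hp : p ∈ polesA x) :
    ∃ i, x i ≠ 0 ∧ (x i)⁻¹ = p := by
  obtain ⟨i, hi, h⟩ := Multiset.mem_map.1 hp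
  rw [Finset.mem_val, Finset.mem_filter] at hi
  exact ⟨i, hi.2, h⟩

theorem exists_of_mem_polesB {k : ℕ} {y : Fin k → ℂ} {p : ℂ} (hp : p ∈ polesB y) :
    ∃ j, -y j = p := by
  obtain ⟨j, _, h⟩ := Multiset.mem_map.1 hp
  exact ⟨j, h⟩

theorem one_sub_mul_ne_zero {t z : ℂ} (h : t ≠ 0 → t⁻¹ ≠ z) : 1 - t * z ≠ 0 := by
  intro h1
  have ht : t ≠ 0 := by
    rintro rfl
    simp at h1
  apply h ht
  field_simp
  linear_combination h1

theorem symbolA_eq {n : ℕ} (x : Fin n → ℂ) :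
    ∃ c : ℂ, ∀ z, symbolA x z = c * poleProd (polesA x) z := by
  refine ⟨∏ i ∈ Finset.univ.filter (fun i => x i ≠ 0), -(x i)⁻¹, fun z => ?_⟩
  have h1 : poleProd (polesA x) z =
      ∏ i ∈ Finset.univ.filter (fun i => x i ≠ 0), (z - (x i)⁻¹)⁻¹ := by
    rw [poleProd, polesA, Multiset.map_map]
    rfl
  rw [h1, ← Finset.prod_mul_distrib, symbolA, ← Finset.prod_filter_of_ne (p := fun i => x i ≠ 0)]
  · refine Finset.prod_congr rfl fun i hi => ?_
    have hx := (Finset.mem_filter.1 hi).2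
    rw [show 1 - x i * z = -x i * (z - (x i)⁻¹) by field_simp; ring, one_div, mul_inv, inv_neg]
  · intro i _ h h0
    exact h (by simp [h0])

theorem symbolB_eq {k : ℕ} (y : Fin k → ℂ) {z : ℂ} (hz : z ≠ 0) :
    symbolB y z = z ^ k * poleProd (polesB y) z := by
  have h1 : poleProd (polesB y) z = ∏ j, (z - -y j)⁻¹ := by
    rw [poleProd, polesB, Multiset.map_map]
    rfl
  have h2 : z ^ k = ∏ _j : Fin k, z := by simp
  rw [h1, h2, ← Finset.prod_mul_distrib, symbolB]
  refine Finset.prod_congr rfl fun j _ => ?_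
  rw [show 1 + y j / z = (z - -y j) / z by field_simp; ring, one_div, inv_div, div_eq_mul_inv]

theorem continuousOn_zpow_of_notMem {S : Set ℂ} (h0 : (0 : ℂ) ∉ S) (e : ℤ) :
    ContinuousOn (fun z : ℂ => z ^ e) S :=
  continuousOn_id.zpow₀ e fun z hz => Or.inl fun h => h0 (by simpa using h ▸ hz)

theorem continuousOn_symbolA {n : ℕ} {x : Fin n → ℂ} {S : Set ℂ}
    (hx : ∀ i, x i ≠ 0 → (x i)⁻¹ ∉ S) : ContinuousOn (symbolA x) S := by
  obtain ⟨c, hc⟩ := symbolA_eq x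
  rw [funext hc]
  refine continuousOn_const.mul (continuousOn_poleProd fun p hp => ?_)
  obtain ⟨i, hi, rfl⟩ := exists_of_mem_polesA hp
  exact hx i hi

theorem continuousOn_symbolB {k : ℕ} {y : Fin k → ℂ} {S : Set ℂ} (h0 : (0 : ℂ) ∉ S)
    (hy : ∀ j, -y j ∉ S) : ContinuousOn (symbolB y) S := by
  have h : ContinuousOn (fun z => z ^ k * poleProd (polesB y) z) S := by
    refine (continuousOn_pow k).mul (continuousOn_poleProd fun p hp => ?_)
    obtain ⟨j, _, rfl⟩ := Multiset.mem_map.1 hp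
    exact hy j
  exact h.congr fun z hz => symbolB_eq y fun h => h0 (h ▸ hz)

theorem symbolA_mul_eval {n : ℕ} {x : Fin n → ℂ} {z : ℂ} (hz : ∀ i, x i ≠ 0 → (x i)⁻¹ ≠ z) :
    symbolA x z * (ePoly fun i => -x i).eval z = 1 := by
  rw [ePoly, Polynomial.eval_prod, symbolA, ← Finset.prod_mul_distrib]
  refine Finset.prod_eq_one fun i _ => ?_
  have h := one_sub_mul_ne_zero (hz i)
  simp only [Polynomial.eval_add, Polynomial.eval_one, Polynomial.eval_mul, Polynomial.eval_C,
    Polynomial.eval_X, neg_mul, ← sub_eq_add_neg]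
  rw [one_div, inv_mul_cancel₀ h]

theorem symbolB_mul_eval {k : ℕ} {y : Fin k → ℂ} {z : ℂ} (h0 : z ≠ 0) (hz : ∀ j, -y j ≠ z) :
    symbolB y z * (ePoly y).eval z⁻¹ = 1 := by
  rw [ePoly, Polynomial.eval_prod, symbolB, ← Finset.prod_mul_distrib]
  refine Finset.prod_eq_one fun j _ => ?_
  have h : 1 + y j / z ≠ 0 := by
    intro h
    apply hz j
    field_simp at h
    linear_combination -h
  simp only [Polynomial.eval_add, Polynomial.eval_one, Polynomial.eval_mul, Polynomial.eval_C,
    Polynomial.eval_X, ← div_eq_mul_inv]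
  rw [one_div, inv_mul_cancel₀ h]

theorem symbolA_inv {n : ℕ} (x : Fin n → ℂ) (w : ℂ) :
    (symbolA x w)⁻¹ = (ePoly fun i => -x i).eval w := by
  rw [ePoly, Polynomial.eval_prod, symbolA, ← Finset.prod_inv_distrib]
  exact Finset.prod_congr rfl fun i _ => by simp [sub_eq_add_neg]

theorem symbolB_inv {k : ℕ} (y : Fin k → ℂ) (w : ℂ) : (symbolB y w)⁻¹ = (ePoly y).eval w⁻¹ := by
  rw [ePoly, Polynomial.eval_prod, symbolB, ← Finset.prod_inv_distrib]
  exact Finset.prod_congr rfl fun i _ => by simp [div_eq_mul_inv]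

theorem eval_ePoly_eq_sum {k : ℕ} (y : Fin k → ℂ) (z : ℂ) :
    (ePoly y).eval z = ∑ q ∈ Finset.range (k + 1), (ePoly y).coeff q * z ^ q :=
  Polynomial.eval_eq_sum_range' (Nat.lt_succ_iff.2 (natDegree_ePoly_le y)) z

/-! ### Fourier coefficients along a contour -/

/-- The coefficient `(2πi)⁻¹ ∮ f(z) z^{-a-1} dz` along the contour `γ`. -/
def contourCoeff (γ : ℝ → ℂ) (f : ℂ → ℂ) (a : ℤ) : ℂ :=
  (2 * Real.pi * Complex.I)⁻¹ * contourIntegral γ fun z => f z * z ^ (-a - 1)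

theorem IsContour.integral_zpow_eq {γ : ℝ → ℂ} (hγ : IsContour γ) (h0 : Encircles γ 0) (e : ℤ) :
    contourIntegral γ (fun z => z ^ e) = if e = -1 then 2 * Real.pi * Complex.I else 0 := by
  split_ifs with he
  · have h := h0.2
    rw [windingNumber, inv_mul_eq_iff_eq_mul₀ two_pi_I_ne_zero, mul_one] at h
    rw [← h, he]
    exact contourIntegral_congr fun z _ => by simp
  · have h := hγ.integral_zpow (p := 0) (e := e) (Or.inl h0.1) he
    simpa using h

/-- Multiplying a function by a Laurent polynomial acts on its contour coefficients by the
corresponding combination of shifts. -/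
theorem IsContour.sum_contourCoeff {γ : ℝ → ℂ} (hγ : IsContour γ) {f g : ℂ → ℂ}
    (h0 : (0 : ℂ) ∉ trace γ) (hf : ContinuousOn f (trace γ)) {N : ℕ} {c : ℕ → ℂ} {σ : ℕ → ℤ}
    (hg : ∀ z ∈ trace γ, f z * ∑ i ∈ Finset.range N, c i * z ^ σ i = g z) (a : ℤ) :
    ∑ i ∈ Finset.range N, c i * contourCoeff γ f (a - σ i) = contourCoeff γ g a := by
  simp only [contourCoeff]
  have h1 : ∀ i, c i * ((2 * Real.pi * Complex.I)⁻¹ *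
      contourIntegral γ fun z => f z * z ^ (-(a - σ i) - 1)) = (2 * Real.pi * Complex.I)⁻¹ *
      contourIntegral γ fun z => c i * (f z * z ^ (-(a - σ i) - 1)) := by
    intro i
    rw [contourIntegral_const_mul]
    ring
  rw [Finset.sum_congr rfl fun i _ => h1 i, ← Finset.mul_sum, ← hγ.integral_sum]
  · congr 1
    refine contourIntegral_congr fun z hz => ?_
    have hz0 : z ≠ 0 := fun h => h0 (h ▸ hz)
    rw [← hg z hz, Finset.mul_sum, Finset.sum_mul]
    refine Finset.sum_congr rfl fun i _ => ?_
    rw [show -(a - σ i) - 1 = σ i + (-a - 1) by ring, zpow_add₀ hz0]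
    ring
  · intro i _
    exact continuousOn_const.mul (hf.mul (continuousOn_zpow_of_notMem h0 _))

theorem contourCoeff_symbolA_of_neg {n : ℕ} {x : Fin n → ℂ} {γ : ℝ → ℂ} (hγ : IsContour γ)
    (hx : ∀ i, x i ≠ 0 → Excludes γ (x i)⁻¹) {t : ℤ} (ht : t < 0) :
    contourCoeff γ (symbolA x) t = 0 := by
  obtain ⟨c, hc⟩ := symbolA_eq x
  obtain ⟨j, hj⟩ := Int.eq_ofNat_of_zero_le (show 0 ≤ -t - 1 by omega)
  rw [contourCoeff, contourIntegral_congr (g := fun z => c * (z ^ j * poleProd (polesA x) z)),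
    contourIntegral_const_mul, hγ.integral_pow_mul_poleProd_of_excluded, mul_zero, mul_zero]
  · intro p hp
    obtain ⟨i, hi, rfl⟩ := exists_of_mem_polesA hp
    exact hx i hi
  · intro z _
    rw [hc, hj, zpow_natCast]
    ring

theorem contourCoeff_symbolA {n : ℕ} {x : Fin n → ℂ} {γ : ℝ → ℂ} (hγ : IsContour γ)
    (h0 : Encircles γ 0) (hx : ∀ i, x i ≠ 0 → Excludes γ (x i)⁻¹) (t : ℤ) :
    contourCoeff γ (symbolA x) t = hZ x t := by
  induction n generalizing t with
  | zero =>
    simp only [contourCoeff, symbolA, Finset.univ_eq_empty, Finset.prod_empty, one_mul]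
    rw [hγ.integral_zpow_eq h0, hZ_fin_zero]
    by_cases h : t = 0
    · simp only [h, if_true, neg_zero, zero_sub]
      exact inv_mul_cancel₀ two_pi_I_ne_zero
    · rw [if_neg h, if_neg (by omega), mul_zero]
  | succ n ih =>
    have hx' : ∀ i : Fin n, x i.castSucc ≠ 0 → Excludes γ (x i.castSucc)⁻¹ := fun i => hx _
    have hrec : ∀ t, contourCoeff γ (symbolA x) t = contourCoeff γ
        (symbolA fun i : Fin n => x i.castSucc) t +
          x (Fin.last n) * contourCoeff γ (symbolA x) (t - 1) := by
      intro t
      have h := hγ.sum_contourCoeff (f := symbolA x) (g := symbolA fun i : Fin n => x i.castSucc)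
        h0.1 (continuousOn_symbolA fun i hi => (hx i hi).1) (N := 2)
        (c := fun i => if i = 0 then 1 else -x (Fin.last n)) (σ := fun i => i) (fun z hz => by
          rw [symbolA, Fin.prod_univ_castSucc]
          simp only [Finset.sum_range_succ, Finset.sum_range_zero, if_true, one_ne_zero, if_false,
            Nat.cast_zero, Nat.cast_one, zpow_zero, zpow_one, zero_add, mul_one, symbolA]
          have hne : 1 - x (Fin.last n) * z ≠ 0 :=
            one_sub_mul_ne_zero fun h h' => (hx _ h).1 (h' ▸ hz)
          rw [neg_mul, ← sub_eq_add_neg, mul_assoc, one_div_mul_cancel hne, mul_one]) t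
      simp only [Finset.sum_range_succ, Finset.sum_range_zero, if_true, one_ne_zero, if_false,
        Nat.cast_zero, Nat.cast_one, sub_zero, zero_add, one_mul] at h
      linear_combination h
    -- Both sequences satisfy the same first-order recurrence in t and vanish for t < 0, so upward
    -- induction from t = -1 identifies them.
    rcases lt_or_ge t (-1) with ht | ht
    · rw [contourCoeff_symbolA_of_neg hγ hx (by omega), hZ_of_neg x (by omega)]
    · induction t, ht using Int.leInduction with
      | base => rw [contourCoeff_symbolA_of_neg hγ hx (by omega), hZ_of_neg x (by omega)]
      | succ t ht iht =>
        rw [hrec, hZ_succ, ih hx', add_sub_cancel_right, iht]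

/-! ### The coefficients of the symbol -/

section

variable {n k : ℕ} {x : Fin n → ℝ} {y : Fin k → ℝ} {γz γw : ℝ → ℂ}

theorem symbolK_eq (x : Fin n → ℝ) (y : Fin k → ℝ) (z : ℂ) :
    symbolK x y z = symbolA (fun i => (x i : ℂ)) z * symbolB (fun j => (y j : ℂ)) z := rfl

theorem AdmissibleContours.excludes (h : AdmissibleContours x y γz γw) (i : Fin n)
    (hi : (x i : ℂ) ≠ 0) : Excludes γz (x i : ℂ)⁻¹ :=
  h.excludes_x i fun h0 => hi (by simp [h0])

theorem AdmissibleContours.continuousOn_symbolK (h : AdmissibleContours x y γz γw) :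
    ContinuousOn (symbolK x y) (trace γz) :=
  (continuousOn_symbolA (x := fun i => (x i : ℂ)) fun i hi => (h.excludes i hi).1).mul
    (continuousOn_symbolB (y := fun j => (y j : ℂ)) h.zero_z.1 fun j => (h.contains_y j).1)

/-- The x-operator cancels the x-factor of the symbol. What remains is z^{k-a-1} over k encircled
poles, with enough decay exactly when a ≥ 1. -/
theorem AdmissibleContours.recurrence_contourCoeff (h : AdmissibleContours x y γz γw) {a : ℤ}
    (ha : 1 ≤ a) :
    recurrence (fun i => (x i : ℂ)) (contourCoeff γz (symbolK x y)) a = 0 := by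
  have h1 := h.contour_z.sum_contourCoeff (g := symbolB fun j => (y j : ℂ)) h.zero_z.1
    h.continuousOn_symbolK (N := n + 1) (c := signedE fun i => (x i : ℂ)) (σ := fun i => i)
    (fun z hz => by
      have h2 := eval_ePoly_eq_sum (fun i => -(x i : ℂ)) z
      simp only [zpow_natCast]
      change _ = ∑ i ∈ Finset.range (n + 1), signedE (fun i => (x i : ℂ)) i * z ^ i at h2
      have h3 := symbolA_mul_eval (x := fun i => (x i : ℂ)) (z := z)
        fun i hi he => (h.excludes i hi).1 (he ▸ hz)
      rw [← h2, symbolK_eq]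
      linear_combination (symbolB (fun j => (y j : ℂ)) z) * h3) a
  refine h1.trans ?_
  rw [contourCoeff, contourIntegral_congr
    (g := fun z => z ^ ((k : ℤ) - a - 1) * poleProd (polesB fun j => (y j : ℂ)) z),
    h.contour_z.integral_zpow_mul_poleProd_of_encircled h.zero_z, mul_zero]
  · intro p hp
    obtain ⟨j, rfl⟩ := exists_of_mem_polesB hp
    exact h.contains_y j
  · simp only [polesB, Multiset.card_map, Finset.card_val, Finset.card_univ, Fintype.card_fin]
    omega
  · intro z hz
    have hz0 : z ≠ 0 := fun h0 => h.zero_z.1 (h0 ▸ hz)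
    rw [symbolB_eq _ hz0, show (k : ℤ) - a - 1 = k + (-a - 1) by ring, zpow_add₀ hz0, zpow_natCast]
    ring

/-- The y-operator cancels the y-factor, leaving ∏ 1/(1 - x_i z) with all its poles excluded. -/
theorem AdmissibleContours.backward_contourCoeff (h : AdmissibleContours x y γz γw) (a : ℤ) :
    backward (fun j => (y j : ℂ)) (contourCoeff γz (symbolK x y)) a =
      hZ (fun i => (x i : ℂ)) a := by
  rw [← contourCoeff_symbolA h.contour_z h.zero_z h.excludes]
  have h1 := h.contour_z.sum_contourCoeff (g := symbolA fun i => (x i : ℂ)) h.zero_z.1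
    h.continuousOn_symbolK (N := k + 1) (c := fun q => (ePoly fun j => (y j : ℂ)).coeff q)
    (σ := fun i => -i)
    (fun z hz => by
      have h2 := eval_ePoly_eq_sum (fun j => (y j : ℂ)) z⁻¹
      simp only [zpow_neg, zpow_natCast, ← inv_pow]
      have h3 := symbolB_mul_eval (y := fun j => (y j : ℂ)) (z := z)
        (fun h0 => h.zero_z.1 (h0 ▸ hz)) fun j he => (h.contains_y j).1 (he ▸ hz)
      rw [← h2, symbolK_eq]
      linear_combination (symbolA (fun i => (x i : ℂ)) z) * h3) a
  simp only [sub_neg_eq_add] at h1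
  exact h1

theorem AdmissibleContours.contourCoeff_eq {γz' γw' : ℝ → ℂ} (h : AdmissibleContours x y γz γw)
    (h' : AdmissibleContours x y γz' γw') :
    contourCoeff γz (symbolK x y) = contourCoeff γz' (symbolK x y) := by
  funext a
  obtain ⟨c, hc⟩ := symbolA_eq fun i => (x i : ℂ)
  let P := polesA (fun i => (x i : ℂ)) + polesB fun j => (y j : ℂ)
  have hK : ∀ γ : ℝ → ℂ, (0 : ℂ) ∉ trace γ → contourCoeff γ (symbolK x y) a =
      (2 * Real.pi * Complex.I)⁻¹ * (c * contourIntegral γ fun z =>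
        z ^ ((k : ℤ) - a - 1) * poleProd P z) := by
    intro γ h0
    rw [contourCoeff, ← contourIntegral_const_mul γ c]
    congr 1
    refine contourIntegral_congr fun z hz => ?_
    have hz0 : z ≠ 0 := fun h => h0 (h ▸ hz)
    rw [symbolK_eq, hc, symbolB_eq _ hz0, poleProd_add,
      show (k : ℤ) - a - 1 = k + (-a - 1) by ring, zpow_add₀ hz0, zpow_natCast]
    ring
  rw [hK _ h.zero_z.1, hK _ h'.zero_z.1,
    h.contour_z.integral_zpow_mul_poleProd_eq h'.contour_z h.zero_z h'.zero_z]
  intro p hp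
  rcases Multiset.mem_add.1 hp with hp | hp
  · obtain ⟨i, hi, rfl⟩ := exists_of_mem_polesA hp
    exact ⟨(h.excludes i hi).1, (h'.excludes i hi).1,
      (h.excludes i hi).2.trans (h'.excludes i hi).2.symm⟩
  · obtain ⟨j, rfl⟩ := exists_of_mem_polesB hp
    exact ⟨(h.contains_y j).1, (h'.contains_y j).1,
      (h.contains_y j).2.trans (h'.contains_y j).2.symm⟩

/-! ### The double contour integral -/

/-- From w^{q+1}/(z - w) = z w^q/(z - w) - w^q one obtains a recurrence in q whose inhomogeneity is
felt only at q = -1. Starting at q = 0, it propagates zero upwards and powers of z downwards. -/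
theorem IsContour.integral_zpow_div_sub {γ : ℝ → ℂ} (hγ : IsContour γ) (h0 : Encircles γ 0)
    {z : ℂ} (hz : ∀ w ∈ trace γ, ‖w‖ < ‖z‖) (q : ℤ) :
    contourIntegral γ (fun w => w ^ q * (z - w)⁻¹) =
      if q < 0 then 2 * Real.pi * Complex.I * z ^ q else 0 := by
  have hne : ∀ w ∈ trace γ, z - w ≠ 0 := fun w hw h => by
    have := hz w hw
    rw [sub_eq_zero.1 h] at this
    exact lt_irrefl _ this
  have hz0 : z ≠ 0 := by
    have hmem : γ 0 ∈ trace γ := Set.mem_image_of_mem γ (Set.left_mem_Icc.2 zero_le_one)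
    exact norm_pos_iff.1 ((norm_nonneg _).trans_lt (hz _ hmem))
  have hci : ContinuousOn (fun w => (z - w)⁻¹) (trace γ) :=
    (continuousOn_const.sub continuousOn_id).inv₀ hne
  have hc : ∀ q : ℤ, ContinuousOn (fun w => w ^ q * (z - w)⁻¹) (trace γ) := fun q =>
    (continuousOn_zpow_of_notMem h0.1 q).mul hci
  have hrec : ∀ q : ℤ, contourIntegral γ (fun w => w ^ (q + 1) * (z - w)⁻¹) =
      z * contourIntegral γ (fun w => w ^ q * (z - w)⁻¹) -
        if q = -1 then 2 * Real.pi * Complex.I else 0 := by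
    intro q
    have hc' : ContinuousOn (fun w => z * (w ^ q * (z - w)⁻¹)) (trace γ) :=
      continuousOn_const.mul (hc q)
    rw [← hγ.integral_zpow_eq h0, ← contourIntegral_const_mul,
      ← hγ.integral_sub hc' (continuousOn_zpow_of_notMem h0.1 q)]
    refine contourIntegral_congr fun w hw => ?_
    have h1 := hne w hw
    have hw0 : w ≠ 0 := fun h => h0.1 (h ▸ hw)
    rw [zpow_add_one₀ hw0]
    field_simp
    ring
  -- As |w/z| < 1 on the contour, 1 - w/z avoids the cut of the principal logarithm, which supplies
  -- a primitive.
  have hbase : contourIntegral γ (fun w => w ^ (0 : ℤ) * (z - w)⁻¹) = 0 := by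
    refine hγ.integral_eq_zero (F := fun w => -Complex.log (1 - w / z)) (hc 0) fun w hw => ?_
    have hs : 1 - w / z ∈ Complex.slitPlane := by
      refine Complex.mem_slitPlane_of_norm_lt_one (z := -(w / z)) ?_
      rw [norm_neg, norm_div, div_lt_one (norm_pos_iff.2 hz0)]
      exact hz w hw
    have h1 : HasDerivAt (fun w => 1 - w / z) (-(1 / z)) w :=
      ((hasDerivAt_id w).div_const z).const_sub 1
    have h2 := (h1.clog hs).neg
    have e : -(-(1 / z) / (1 - w / z)) = w ^ (0 : ℤ) * (z - w)⁻¹ := by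
      have h3 := hne w hw
      have h4 : 1 - w / z ≠ 0 := Complex.slitPlane_ne_zero hs
      rw [show 1 - w / z = (z - w) / z by field_simp]
      field_simp
    rw [e] at h2
    exact h2
  rcases le_or_gt 0 q with hq | hq
  · rw [if_neg (by omega)]
    induction q, hq using Int.leInduction with
    | base => exact hbase
    | succ q hq ih => rw [hrec, ih, if_neg (by omega)]; simp
  · have key : ∀ p : ℕ, contourIntegral γ (fun w => w ^ (-(p : ℤ) - 1) * (z - w)⁻¹) =
        2 * Real.pi * Complex.I * z ^ (-(p : ℤ) - 1) := by
      intro p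
      induction p with
      | zero =>
        have h1 := hrec (-1)
        rw [show (-1 : ℤ) + 1 = 0 by ring, hbase, if_pos rfl] at h1
        simp only [Nat.cast_zero, neg_zero, zero_sub]
        have h2 : z * z ^ (-1 : ℤ) = 1 := by rw [zpow_neg_one, mul_inv_cancel₀ hz0]
        refine mul_left_cancel₀ hz0 ?_
        linear_combination -h1 - (2 * Real.pi * Complex.I) * h2
      | succ p ih =>
        have h1 := hrec (-((p + 1 : ℕ) : ℤ) - 1)
        rw [show -((p + 1 : ℕ) : ℤ) - 1 + 1 = -(p : ℤ) - 1 by push_cast; ring, ih,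
          if_neg (by omega), sub_zero] at h1
        have h2 : z ^ (-(p : ℤ) - 1) = z * z ^ (-((p + 1 : ℕ) : ℤ) - 1) := by
          rw [← zpow_one_add₀ hz0]
          congr 1
          push_cast
          ring
        rw [h2] at h1
        refine mul_left_cancel₀ hz0 ?_
        linear_combination -h1
    rw [if_pos hq]
    obtain ⟨p, hp⟩ := Int.eq_ofNat_of_zero_le (show 0 ≤ -q - 1 by omega)
    rw [show q = -(p : ℤ) - 1 by omega]
    exact key p

theorem symbolK_inv_eq_sum (x : Fin n → ℝ) (y : Fin k → ℝ) {w : ℂ} (hw : w ≠ 0) :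
    (symbolK x y w)⁻¹ = ∑ i ∈ Finset.range (n + 1), ∑ j ∈ Finset.range (k + 1),
      signedE (fun i => (x i : ℂ)) i * (ePoly fun j => (y j : ℂ)).coeff j *
        w ^ ((i : ℤ) - j) := by
  rw [symbolK_eq, mul_inv, symbolA_inv, symbolB_inv, eval_ePoly_eq_sum, eval_ePoly_eq_sum,
    Finset.sum_mul_sum]
  refine Finset.sum_congr rfl fun i _ => Finset.sum_congr rfl fun j _ => ?_
  rw [zpow_sub₀ hw, zpow_natCast, zpow_natCast, inv_pow, signedE]
  field_simp

theorem kernelIntegrand_eq (x : Fin n → ℝ) (y : Fin k → ℝ) {M M' : ℤ} {m m' : ℝ}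
    (hm : m = M - 1 / 2) (hm' : m' = M' - 1 / 2) {z w : ℂ} (hz : z ≠ 0) (hw : w ≠ 0) :
    kernelIntegrand x y m m' z w =
      symbolK x y z * z ^ (1 - M) * ((symbolK x y w)⁻¹ * w ^ M' * (z - w)⁻¹) := by
  have h1 : z ^ (-(m : ℂ)) * z ^ (1 / 2 : ℂ) = z ^ (1 - M) := by
    rw [← Complex.cpow_add _ _ hz, ← Complex.cpow_intCast]
    congr 1
    rw [hm]
    push_cast
    ring
  have h2 : w ^ (m' : ℂ) * w ^ (1 / 2 : ℂ) = w ^ M' := by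
    rw [← Complex.cpow_add _ _ hw, ← Complex.cpow_intCast]
    congr 1
    rw [hm']
    push_cast
    ring
  rw [kernelIntegrand, ← h1, ← h2]
  ring

theorem AdmissibleContours.kernelIntegral_eq (h : AdmissibleContours x y γz γw) {M M' : ℤ}
    {m m' : ℝ} (hm : m = M - 1 / 2) (hm' : m' = M' - 1 / 2) :
    kernelIntegral x y γz γw m m' = kerZ (fun i => (x i : ℂ)) (fun j => (y j : ℂ))
      (contourCoeff γz (symbolK x y)) M M' := by
  have hpi := two_pi_I_ne_zero
  let c : ℕ → ℕ → ℂ := fun i j =>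
    signedE (fun i => (x i : ℂ)) i * (ePoly fun j => (y j : ℂ)).coeff j
  have hinner : ∀ z ∈ trace γz, (contourIntegral γw fun w =>
      1 / (2 * Real.pi * Complex.I * w) * kernelIntegrand x y m m' z w) =
      symbolK x y z * z ^ (1 - M) * ∑ i ∈ Finset.range (n + 1), ∑ j ∈ Finset.range (k + 1),
        if M' + i ≤ j then c i j * z ^ ((i : ℤ) - j + M' - 1) else 0 := by
    intro z hz
    have hz0 : z ≠ 0 := fun h0 => h.zero_z.1 (h0 ▸ hz)
    have hzw := h.norm_lt z hz
    have hcont : ∀ q : ℤ, ContinuousOn (fun w => w ^ q * (z - w)⁻¹) (trace γw) := fun q =>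
      (continuousOn_zpow_of_notMem h.zero_w.1 q).mul
        ((continuousOn_const.sub continuousOn_id).inv₀ fun w hw h0 =>
          (hzw w hw).ne (by rw [show z = w from sub_eq_zero.1 h0]))
    have hcontc : ∀ i j : ℕ, ContinuousOn (fun w => c i j *
        (w ^ ((i : ℤ) - j + M' - 1) * (z - w)⁻¹)) (trace γw) := fun i j =>
      continuousOn_const.mul (hcont _)
    rw [contourIntegral_congr (g := fun w => (symbolK x y z * z ^ (1 - M) *
      (2 * Real.pi * Complex.I)⁻¹) * ∑ i ∈ Finset.range (n + 1), ∑ j ∈ Finset.range (k + 1),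
        c i j * (w ^ ((i : ℤ) - j + M' - 1) * (z - w)⁻¹))]
    · rw [contourIntegral_const_mul, h.contour_w.integral_sum _ fun i _ =>
        continuousOn_finsetSum _ fun j _ => hcontc i j, mul_assoc]
      congr 1
      rw [Finset.mul_sum]
      refine Finset.sum_congr rfl fun i _ => ?_
      rw [h.contour_w.integral_sum _ fun j _ => hcontc i j, Finset.mul_sum]
      refine Finset.sum_congr rfl fun j _ => ?_
      rw [contourIntegral_const_mul, h.contour_w.integral_zpow_div_sub h.zero_w hzw]
      -- The extra -1 in the exponent comes from dw/w; it turns "exponent negative" into M' + i ≤ j.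
      by_cases hc : M' + i ≤ j
      · rw [if_pos hc, if_pos (by omega)]
        field_simp
      · rw [if_neg hc, if_neg (by omega), mul_zero, mul_zero]
    · intro w hw
      have hw0 : w ≠ 0 := fun h0 => h.zero_w.1 (h0 ▸ hw)
      rw [kernelIntegrand_eq x y hm hm' hz0 hw0, symbolK_inv_eq_sum x y hw0, Finset.sum_mul,
        Finset.sum_mul, Finset.mul_sum, Finset.mul_sum, Finset.mul_sum]
      refine Finset.sum_congr rfl fun i _ => ?_
      rw [Finset.sum_mul, Finset.sum_mul, Finset.mul_sum, Finset.mul_sum, Finset.mul_sum]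
      refine Finset.sum_congr rfl fun j _ => ?_
      rw [show (i : ℤ) - j + M' - 1 = ((i : ℤ) - j) + M' + (-1) by ring, zpow_add₀ hw0,
        zpow_add₀ hw0, zpow_neg_one, one_div, mul_inv]
      ring
  have hcontK : ∀ e : ℤ, ContinuousOn (fun z => symbolK x y z * z ^ e) (trace γz) := fun e =>
    h.continuousOn_symbolK.mul (continuousOn_zpow_of_notMem h.zero_z.1 e)
  have hcontc : ∀ i j : ℕ, ContinuousOn (fun z => (if M' + i ≤ j then c i j else 0) *
      (symbolK x y z * z ^ (-(M - M' - i + j) - 1))) (trace γz) := fun i j =>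
    continuousOn_const.mul (hcontK _)
  rw [kernelIntegral, contourIntegral_congr (g := fun z => (2 * Real.pi * Complex.I)⁻¹ *
    ∑ i ∈ Finset.range (n + 1), ∑ j ∈ Finset.range (k + 1),
      (if M' + i ≤ j then c i j else 0) * (symbolK x y z * z ^ (-(M - M' - i + j) - 1)))]
  · rw [contourIntegral_const_mul, h.contour_z.integral_sum _ fun i _ =>
      continuousOn_finsetSum _ fun j _ => hcontc i j, Finset.mul_sum, kerZ]
    refine Finset.sum_congr rfl fun i _ => ?_
    rw [h.contour_z.integral_sum _ fun j _ => hcontc i j, Finset.mul_sum]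
    refine Finset.sum_congr rfl fun j _ => ?_
    rw [contourIntegral_const_mul, contourCoeff]
    split_ifs
    · simp only [c]
      ring
    · ring
  · intro z hz
    have hz0 : z ≠ 0 := fun h0 => h.zero_z.1 (h0 ▸ hz)
    rw [hinner z hz, Finset.mul_sum, Finset.mul_sum, Finset.mul_sum]
    refine Finset.sum_congr rfl fun i _ => ?_
    rw [Finset.mul_sum, Finset.mul_sum, Finset.mul_sum]
    refine Finset.sum_congr rfl fun j _ => ?_
    split_ifs
    · rw [show -(M - M' - i + j) - 1 = (1 - M) + ((i : ℤ) - j + M' - 1) + (-1) by ring,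
        zpow_add₀ hz0, zpow_add₀ hz0, zpow_neg_one, one_div, mul_inv]
      ring
    · ring

/-! ### Circles are contours -/

/-- The circle of centre `a` and radius `R`, parametrized by `[0, 1]`. -/
def circleContour (a : ℂ) (R : ℝ) (t : ℝ) : ℂ := circleMap a R (2 * Real.pi * t)

theorem isContour_circleContour (a : ℂ) (R : ℝ) : IsContour (circleContour a R) := by
  refine ⟨?_, 1, fun i => i, Nat.mono_cast, by simp, by simp, fun i _ => ?_⟩
  · simp [circleContour, circleMap, Complex.exp_two_pi_mul_I]
  · exact ((contDiff_circleMap a R).comp (contDiff_const.mul contDiff_id)).contDiffOn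

theorem contourIntegral_circleContour (a : ℂ) (R : ℝ) (f : ℂ → ℂ) :
    contourIntegral (circleContour a R) f = circleIntegral f a R := by
  have hd : ∀ t, deriv (circleContour a R) t =
      (2 * Real.pi) • deriv (circleMap a R) (2 * Real.pi * t) := by
    intro t
    have h1 : HasDerivAt (fun t : ℝ => 2 * Real.pi * t) (2 * Real.pi) t := by
      simpa using (hasDerivAt_id t).const_mul (2 * Real.pi)
    rw [deriv_circleMap]
    exact ((hasDerivAt_circleMap a R (2 * Real.pi * t)).scomp t h1).deriv
  have h := intervalIntegral.smul_integral_comp_mul_left (a := 0) (b := 1)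
    (fun θ => deriv (circleMap a R) θ • f (circleMap a R θ)) (2 * Real.pi)
  rw [mul_zero, mul_one] at h
  rw [contourIntegral, circleIntegral, ← h, ← intervalIntegral.integral_smul]
  refine intervalIntegral.integral_congr fun t _ => ?_
  rw [hd]
  simp only [circleContour, smul_eq_mul, Complex.real_smul]
  ring

theorem norm_sub_of_mem_trace_circleContour {a : ℂ} {R : ℝ} (hR : 0 ≤ R) {z : ℂ}
    (hz : z ∈ trace (circleContour a R)) : ‖z - a‖ = R := by
  obtain ⟨t, _, rfl⟩ := hz
  rw [circleContour, circleMap_sub_center, norm_circleMap_zero, abs_of_nonneg hR]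

theorem encircles_circleContour {a p : ℂ} {R : ℝ} (hp : ‖p - a‖ < R) :
    Encircles (circleContour a R) p := by
  have hR : 0 ≤ R := (norm_nonneg _).trans hp.le
  refine ⟨fun h => ?_, ?_⟩
  · exact hp.ne (norm_sub_of_mem_trace_circleContour hR h)
  · rw [windingNumber, contourIntegral_circleContour, circleIntegral.integral_sub_inv_of_mem_ball
      (mem_ball_iff_norm.2 hp), inv_mul_cancel₀ two_pi_I_ne_zero]

theorem excludes_circleContour {a p : ℂ} {R : ℝ} (hR : 0 ≤ R) (hp : R < ‖p - a‖) :
    Excludes (circleContour a R) p := by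
  refine ⟨fun h => hp.ne' (norm_sub_of_mem_trace_circleContour hR h), ?_⟩
  rw [windingNumber, contourIntegral_circleContour, DiffContOnCl.circleIntegral_eq_zero hR, mul_zero]
  refine DifferentiableOn.diffContOnCl fun z hz => ?_
  have hz' : ‖z - a‖ ≤ R := mem_closedBall_iff_norm.1 (Metric.closure_ball_subset_closedBall hz)
  have hne : z - p ≠ 0 := by
    intro h
    rw [sub_eq_zero.1 h] at hz'
    exact absurd hp (not_lt.2 hz')
  exact ((differentiableAt_id.sub_const p).inv hne).differentiableWithinAt

/-- The z-circle is centred at -c, so that it reaches left past every -y_j while crossing the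
positive axis only at 1/s, before every 1/x_i. It stays at distance at least 1/s from 0, so radius
1/(2s) serves for w. -/
theorem exists_admissibleContours (hx : ∀ i, 0 ≤ x i) (hy : ∀ j, 0 ≤ y j) :
    ∃ γz γw : ℝ → ℂ, AdmissibleContours x y γz γw := by
  set c : ℝ := ∑ j, y j with hc
  set s : ℝ := 1 + ∑ i, x i with hs
  have hc0 : 0 ≤ c := Finset.sum_nonneg fun j _ => hy j
  have hs0 : 0 < s := by
    have := Finset.sum_nonneg fun i (_ : i ∈ Finset.univ) => hx i
    linarith
  have he : 0 < s⁻¹ := inv_pos.2 hs0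
  have hcn : ‖-(c : ℂ)‖ = c := by rw [norm_neg, Complex.norm_real, Real.norm_of_nonneg hc0]
  refine ⟨circleContour (-c) (c + s⁻¹), circleContour 0 (s⁻¹ / 2), isContour_circleContour _ _,
    isContour_circleContour _ _, ?_, ?_, ?_, ?_, ?_⟩
  · intro z hz w hw
    have h1 := norm_sub_of_mem_trace_circleContour (by linarith) hz
    have h2 := norm_sub_of_mem_trace_circleContour (by linarith) hw
    rw [sub_zero] at h2
    have h3 := norm_sub_le z (-(c : ℂ))
    linarith
  · refine encircles_circleContour ?_
    rw [zero_sub, neg_neg, Complex.norm_real, Real.norm_of_nonneg hc0]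
    linarith
  · refine encircles_circleContour ?_
    simpa using he
  · intro j
    refine encircles_circleContour ?_
    have hj : y j ≤ c := Finset.single_le_sum (fun j _ => hy j) (Finset.mem_univ j)
    have h1 := hy j
    rw [show -(y j : ℂ) - -(c : ℂ) = ((c - y j : ℝ) : ℂ) by push_cast; ring, Complex.norm_real,
      Real.norm_of_nonneg (by linarith)]
    linarith
  · intro i hi
    refine excludes_circleContour (by linarith) ?_
    have hxi : 0 < x i := lt_of_le_of_ne (hx i) (Ne.symm hi)
    have h1 : x i < s := by
      have := Finset.single_le_sum (fun i _ => hx i) (Finset.mem_univ i)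
      linarith
    have h2 : s⁻¹ < (x i)⁻¹ := inv_strictAnti₀ hxi h1
    rw [show (x i : ℂ)⁻¹ - -(c : ℂ) = ((c + (x i)⁻¹ : ℝ) : ℂ) by push_cast; ring,
      Complex.norm_real, Real.norm_of_nonneg (by positivity)]
    linarith

theorem mayaCoord_eq (lam : YoungDiagram) (i : ℕ) :
    mayaCoord lam i = (coord lam i : ℝ) - 1 / 2 := by
  rw [mayaCoord, coord]
  push_cast
  ring

end

end DualCauchy

end

/-! ### The theorem, by passing from half-integers to integer coordinates -/

theorem theorem1p1 (n k : ℕ) (x : Fin n → ℝ) (y : Fin k → ℝ)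
    (hx : ∀ i, 0 ≤ x i) (hy : ∀ j, 0 ≤ y j) :
    (∃ γz γw : ℝ → ℂ, DualCauchy.AdmissibleContours x y γz γw) ∧
    ∃ 𝒦 : ℝ → ℝ → ℂ,
      (∀ γz γw : ℝ → ℂ, DualCauchy.AdmissibleContours x y γz γw →
        ∀ m ∈ DualCauchy.halfIntegers, ∀ m' ∈ DualCauchy.halfIntegers,
          𝒦 m m' = DualCauchy.kernelIntegral x y γz γw m m') ∧
      (∀ lam ∈ DualCauchy.boxDiagrams n k,
        (DualCauchy.dualCauchyMeasure x y lam : ℂ) =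
          Matrix.det (Matrix.of fun i j : Fin n =>
            𝒦 (DualCauchy.mayaCoord lam i) (DualCauchy.mayaCoord lam j))) ∧
      (∀ (r : ℕ) (s : Fin r → ℝ), Function.Injective s →
        (∀ i, s i ∈ DualCauchy.halfIntegers) →
        (DualCauchy.correlation x y s : ℂ) =
          Matrix.det (Matrix.of fun i j : Fin r => 𝒦 (s i) (s j))) := by
  obtain ⟨γz, γw, h⟩ := DualCauchy.exists_admissibleContours hx hy
  have hker := fun {M M' : ℤ} {m m' : ℝ} => h.kernelIntegral_eq (M := M) (M' := M') (m := m) (m' := m')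
  refine ⟨⟨γz, γw, h⟩, DualCauchy.kernelIntegral x y γz γw, ?_, ?_, ?_⟩
  · rintro γz' γw' h' m ⟨a, rfl⟩ m' ⟨a', rfl⟩
    -- `halfIntegers` is written as b + 1/2, whereas Maya coordinates are `coord` - 1/2; hence the
    -- shift by one.
    have e : ∀ b : ℤ, (b : ℝ) + 1 / 2 = ((b + 1 : ℤ) : ℝ) - 1 / 2 := fun b => by push_cast; ring
    rw [h.kernelIntegral_eq (e a) (e a'), h'.kernelIntegral_eq (e a) (e a'), h.contourCoeff_eq h']
  · intro lam hl
    simp only [hker (DualCauchy.mayaCoord_eq lam _) (DualCauchy.mayaCoord_eq lam _)]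
    exact DualCauchy.dualCauchyMeasure_eq_det_kerZ x y _ hx hy
      (fun a ha => h.recurrence_contourCoeff ha) h.backward_contourCoeff hl
  · intro r s hs hh
    choose b hb using hh
    have e : ∀ i, s i = ((b i + 1 : ℤ) : ℝ) - 1 / 2 := fun i => by rw [hb]; push_cast; ring
    simp only [hker (e _) (e _)]
    rw [← DualCauchy.correlation_eq_det_kerZ x y _ hx hy
      (fun a ha => h.recurrence_contourCoeff ha) h.backward_contourCoeff (fun i => b i + 1)
      (fun i j hij => hs (by rw [e i, e j]; exact congrArg (fun c : ℤ => (c : ℝ) - 1 / 2) hij)),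
      DualCauchy.correlation]
    push_cast
    refine Finset.sum_congr ?_ fun _ _ => rfl
    ext lam
    simp only [Finset.mem_filter, and_congr_right_iff]
    refine fun _ => forall_congr' fun i => ?_
    simp only [DualCauchy.mayaDiagram, Set.mem_range, DualCauchy.mayaCoord_eq, e i,
      sub_left_inj, Int.cast_inj]
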